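/- Let $\mathcal X$ (states) and $\mathcal U$ (controls) be Borel spaces (Borel subsets of Polish spaces), let $U:\mathcal X\rightrightarrows\mathcal U$ have nonempty values, let $Q$ be a transition kernel from $\operatorname{graph}(U)$ to $\mathcal X$, and let $c:\mathcal X\times\mathcal U\times\mathcal X\to\mathbb R$ be a cost function. Let $P_0$ be a probability measure on $\mathcal X$, $p\in[1,\infty)$, $1/p+1/q=1$, $\mathcal V=L_p(\mathcal X,P_0)$, and let $\mathcal M$ be the set of probability measures $m\ll P_0$ with density in $L_q(\mathcal X,P_0)$, endowed with the weak$^*$ topology defined by the functionals $m\mapsto\int\varphi\,dm$, $\varphi\in\mathcal V$. Let $w:\mathcal X\to[1,\infty)$ be a measurable function in $\mathcal V$. Let $\sigma:\mathcal V\times\mathcal X\times\mathcal M\to\mathbb R$ be a risk transition mapping: it is measurable, and for all $x,m$ the functional $\sigma(\cdot,x,m)$ is a coherent measure of risk on $\mathcal V$ (convex, monotone, positively homogeneous, and $\sigma(a+\varphi,x,m)=a+\sigma(\varphi,x,m)$ for constants $a$). Assume: - (G0) $Q(x,u)\in\mathcal M$ for all $(x,u)\in\operatorname{graph}(U)$;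 - (G1) $Q$ is weak$^*$ continuous: $(x,u)\mapsto\int\varphi(y)\,Q(dy|x,u)$ is continuous on $\operatorname{graph}(U)$ for every $\varphi\in\mathcal V$; - (G2) the multifunction $(x,m)\mapsto\mathcal A(x,m)=\partial_\varphi\sigma(0,x,m)\subset\mathcal M$ is lower semicontinuous on $\mathcal X\times\mathcal M$; - (G3) $c$ is measurable, $|c(x,u,y)|\le C(w(x)+w(y))$ for some constant $C$ and all $x\in\mathcal X$, $u\in U(x)$, $y\in\mathcal X$, and $c(\cdot,\cdot,y)$ is lower semicontinuous on $\operatorname{graph}(U)$ for every $y$; - (G4) $U$ is measurable and compact-valued. Let $v_{T+1}:\mathcal X\to\mathbb R$ be measurable with $|v_{T+1}|\le Cw$ for some constant $C$. For a deterministic policy $\Pi=(\pi_1,\pi_2,\dots)$, i.e. measurable $\pi_t$ assigning to each history $h_t=(x_1,u_1,\dots,x_{t-1},u_{t-1},x_t)$ a control $\pi_t(h_t)\in U(x_t)$, let $$J_T(\Pi,x_1)=\rho_1^\Pi\Big(c(x_1,u_1,x_2)+\rho_2^\Pi\big(c(x_2,u_2,x_3)+\cdots+\rho_T^\Pi(c(x_T,u_T,x_{T+1})+v_{T+1}(x_{T+1}))\cdots\big)\Big),$$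 where $u_t=\pi_t(h_t)$ and $\rho_t^\Pi$ is the Markov one-step conditional risk measure $$\rho_t^\Pi(Z)(h_t)=\sigma\big(Z(h_t,\pi_t(h_t),\cdot),\,x_t,\,Q(x_t,\pi_t(h_t))\big).$$ The value $J_T(\Pi,\cdot)$ is well defined if at each stage $t\le T$ and after each history the argument of $\sigma$ belongs to $\mathcal V$. Assume that $J_T(\Pi,\cdot)$ is well defined for every Markov policy, i.e. for every policy with $\pi_t(h_t)=\pi_t(x_t)$ for all $t$. Then the dynamic programming equations $$v_t(x)=\min_{u\in U(x)}\sigma\big(c(x,u,\cdot)+v_{t+1}(\cdot),x,Q(x,u)\big),\qquad x\in\mathcal X,\ t=T,\dots,1,\tag{1}$$ have a solution, with $v_1,\dots,v_T$ measurable and $v_2,\dots,v_T\in\mathcal V$, all minima being attained. The problem of minimizing $J_T(\Pi,x_1)$ over the deterministic policies $\Pi$ for which $J_T(\Pi,\cdot)$ is well defined has an optimal solution, and its optimal value is $v_1(x_1)$, for every initial state $x_1\in\mathcal X$. Moreover, there is a Markov policy $\hat\Pi=\{\hat\pi_1,\dots,\hat\pi_T\}$ which is optimal for every initial state and satisfies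 $$\hat\pi_t(x)\in\operatorname*{argmin}_{u\in U(x)}\sigma\big(c(x,u,\cdot)+v_{t+1}(\cdot),x,Q(x,u)\big),\qquad x\in\mathcal X,\ t=T,\dots,1.\tag{2}$$ Conversely, for every solution of (1)-(2), with measurable $\hat\pi_t$, the Markov policy $\hat\Pi$ is optimal, and $v_1$ is the optimal value. -/

import Mathlib

open MeasureTheory ProbabilityTheory Set Filter Topology
open scoped ENNReal

namespace RiskMDP

noncomputable section

/-! ### Multifunctions -/

/-- A multifunction into a topological space is measurable if the inverse image
`{x | F x ∩ O ≠ ∅}` of every open set `O` is measurable. -/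
def MeasurableMultifunction {X Y : Type*} [MeasurableSpace X] [TopologicalSpace Y]
    (F : X → Set Y) : Prop :=
  ∀ O : Set Y, IsOpen O → MeasurableSet {x | (F x ∩ O).Nonempty}

/-- Lower semicontinuity of a multifunction, tested along sequences of arguments: whenever
`y k → y` and the open set `O` meets `F y`, it meets `F (y k)` for all large `k`.  (This follows both
from the purely topological notion and from the sequential one, in which every `z ∈ F y` is a limit
of some `z k ∈ F (y k)`; the three coincide when the spaces are metrizable.) -/
def LowerSemicontMultifunction {Y Z : Type*} [TopologicalSpace Y] [TopologicalSpace Z]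
    (F : Y → Set Z) : Prop :=
  ∀ (y : Y) (ys : ℕ → Y), Tendsto ys atTop (𝓝 y) →
    ∀ O : Set Z, IsOpen O → (F y ∩ O).Nonempty → ∀ᶠ k in atTop, (F (ys k) ∩ O).Nonempty

/-! ### The space `𝓥 = L_p(X, P₀)` and the set `𝓜` of probability measures in its dual -/

section Spaces

variable {X : Type*} [MeasurableSpace X]

/-- The Borel σ-algebra of the normed space `L_p(X, P₀)`. -/
instance instMeasurableSpaceLp (p : ℝ≥0∞) [Fact (1 ≤ p)] (P₀ : Measure X) :
    MeasurableSpace (Lp ℝ p P₀) := borel _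

/-- The class of a function `φ ∈ 𝓛_p(X, P₀)` in `L_p(X, P₀)` (with the dummy value `0` when `φ` is
not in `𝓛_p(X, P₀)`). -/
def toV (p : ℝ≥0∞) (P₀ : Measure X) (φ : X → ℝ) : Lp ℝ p P₀ :=
  open Classical in if h : MemLp φ p P₀ then h.toLp φ else 0

/-- The measure `m` is absolutely continuous with respect to `P₀` with density in `L_q(X, P₀)`,
`1/p + 1/q = 1`. -/
def InDual (p : ℝ≥0∞) (P₀ m : Measure X) : Prop :=
  m ≪ P₀ ∧ MemLp (fun y => (m.rnDeriv P₀ y).toReal) (ENNReal.conjExponent p) P₀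

/-- The set `𝓜` of the probability measures in the dual of `L_p(X, P₀)`. -/
def DualProb (p : ℝ≥0∞) (P₀ : Measure X) : Type _ :=
  {m : Measure X // IsProbabilityMeasure m ∧ InDual p P₀ m}

/-- The weak* topology on `𝓜`: the coarsest one that makes `m ↦ ∫ φ dm` continuous for all
`φ ∈ L_p(X, P₀)`. -/
instance (p : ℝ≥0∞) (P₀ : Measure X) : TopologicalSpace (DualProb p P₀) :=
  TopologicalSpace.induced (fun m (φ : Lp ℝ p P₀) => ∫ y, φ y ∂m.1) inferInstance

/-- The σ-algebra on `𝓜` generated by the evaluations `m ↦ m B`. -/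
instance (p : ℝ≥0∞) (P₀ : Measure X) : MeasurableSpace (DualProb p P₀) :=
  MeasurableSpace.comap (fun m => m.1) inferInstance

/-- Coherent measures of risk on `L_p(X, P₀)`. -/
structure IsCoherent {p : ℝ≥0∞} {P₀ : Measure X} [IsProbabilityMeasure P₀]
    (ρ : Lp ℝ p P₀ → ℝ) : Prop where
  convex : ∀ (a : ℝ) (φ ψ : Lp ℝ p P₀), 0 < a → a < 1 →
    ρ (a • φ + (1 - a) • ψ) ≤ a * ρ φ + (1 - a) * ρ ψ
  mono : ∀ φ ψ : Lp ℝ p P₀, φ ≤ ψ → ρ φ ≤ ρ ψ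
  translation : ∀ (a : ℝ) (φ : Lp ℝ p P₀), ρ (Lp.const p P₀ a + φ) = a + ρ φ
  homogeneous : ∀ (b : ℝ) (φ : Lp ℝ p P₀), 0 ≤ b → ρ (b • φ) = b * ρ φ

/-- Risk transition mappings `σ : 𝓥 × X × 𝓜 → ℝ`. -/
structure IsRiskTransitionMapping {p : ℝ≥0∞} [Fact (1 ≤ p)] {P₀ : Measure X}
    [IsProbabilityMeasure P₀] (σ : Lp ℝ p P₀ → X → DualProb p P₀ → ℝ) : Prop where
  measurable : Measurable fun z : Lp ℝ p P₀ × X × DualProb p P₀ => σ z.1 z.2.1 z.2.2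
  coherent : ∀ (x : X) (m : DualProb p P₀), IsCoherent fun φ => σ φ x m

/-- The subdifferential `𝓐(x, m) = ∂_φ σ(0, x, m)`, a set of probability measures in the dual. -/
def subdiff {p : ℝ≥0∞} {P₀ : Measure X} (σ : Lp ℝ p P₀ → X → DualProb p P₀ → ℝ)
    (x : X) (m : DualProb p P₀) : Set (DualProb p P₀) :=
  {μ | ∀ φ : Lp ℝ p P₀, σ 0 x m + ∫ y, φ y ∂μ.1 ≤ σ φ x m}

/-- Weight (bounding) functions `w : X → [1, ∞)`, `w ∈ 𝓥`. -/
structure IsWeight (p : ℝ≥0∞) (P₀ : Measure X) (w : X → ℝ) : Prop where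
  measurable : Measurable w
  one_le : ∀ x, 1 ≤ w x
  memLp : MemLp w p P₀

end Spaces

/-! ### Controlled Markov models, histories and policies -/

/-- A controlled Markov model: nonempty control sets `U x`, a controlled transition kernel `Q` defined
on the graph of `U`, and a cost function `c`. -/
structure Model (X 𝒰 : Type*) [MeasurableSpace X] [MeasurableSpace 𝒰] where
  /-- the sets of feasible controls -/
  U : X → Set 𝒰
  U_nonempty : ∀ x, (U x).Nonempty
  /-- the controlled transition kernel -/
  Q : Kernel {z : X × 𝒰 // z.2 ∈ U z.1} X
  Q_markov : IsMarkovKernel Q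
  /-- the cost `c x u y` of a transition from `x` to `y` under control `u` -/
  c : X → 𝒰 → X → ℝ

variable {X 𝒰 : Type*} [MeasurableSpace X] [MeasurableSpace 𝒰]

namespace Model

variable (D : Model X 𝒰)

/-- The graph of the multifunction `U`. -/
abbrev Graph : Type _ := {z : X × 𝒰 // z.2 ∈ D.U z.1}

/-- Histories `(x₀, u₀, …, xₙ₋₁, uₙ₋₁, xₙ)`.  Stages are numbered from `0`, so that stage `n` is
time `t = n + 1`. -/
abbrev Hist (n : ℕ) : Type _ := (Fin n → D.Graph) × X

variable {D}

/-- Extends a history by a feasible control at its last state and by a next state. -/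
def Hist.append {n : ℕ} (h : D.Hist n) (u : 𝒰) (hu : u ∈ D.U h.2) (y : X) : D.Hist (n + 1) :=
  (Fin.snoc (α := fun _ => D.Graph) h.1 ⟨(h.2, u), hu⟩, y)

/-- The cost `c(xₙ, uₙ, xₙ₊₁)` of the last transition of a history. -/
def lastCost {n : ℕ} (h : D.Hist (n + 1)) : ℝ :=
  D.c (h.1 (Fin.last n)).1.1 (h.1 (Fin.last n)).1.2 h.2

variable (D)

/-- Deterministic (in general history-dependent) policies. -/
structure Policy where
  /-- the decision rules -/
  rule : (n : ℕ) → D.Hist n → 𝒰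
  measurable : ∀ n, Measurable (rule n)
  feasible : ∀ n (h : D.Hist n), rule n h ∈ D.U h.2

/-- Deterministic Markov policies. -/
structure MarkovPolicy where
  /-- the decision rules -/
  rule : ℕ → X → 𝒰
  measurable : ∀ n, Measurable (rule n)
  feasible : ∀ n x, rule n x ∈ D.U x

variable {D}

/-- A Markov policy as a policy. -/
def MarkovPolicy.toPolicy (π : D.MarkovPolicy) : D.Policy where
  rule n h := π.rule n h.2
  measurable n := (π.measurable n).comp measurable_snd
  feasible n h := π.feasible n h.2

variable (D)

/-! ### General conditions -/

/-- (G0): the transition probabilities belong to the dual of `L_p(X, P₀)`. -/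
def G0 (p : ℝ≥0∞) (P₀ : Measure X) : Prop := ∀ z : D.Graph, InDual p P₀ (D.Q z)

/-- (G1): weak* continuity of the kernel on the graph of `U`. -/
def G1 [TopologicalSpace X] [TopologicalSpace 𝒰] (p : ℝ≥0∞) (P₀ : Measure X) : Prop :=
  ∀ φ : Lp ℝ p P₀, Continuous fun z : D.Graph => ∫ y, φ y ∂(D.Q z)

/-- (G3): the cost function is measurable, `w`-bounded, and lower semicontinuous in its first two
arguments (on the graph of `U`). -/
structure G3 [TopologicalSpace X] [TopologicalSpace 𝒰] (w : X → ℝ) : Prop where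
  measurable : Measurable fun z : X × 𝒰 × X => D.c z.1 z.2.1 z.2.2
  bounded : ∃ C : ℝ, 0 < C ∧ ∀ x, ∀ u ∈ D.U x, ∀ y, |D.c x u y| ≤ C * (w x + w y)
  lsc : ∀ y, LowerSemicontinuous fun z : D.Graph => D.c z.1.1 z.1.2 y

/-- (G4): the multifunction `U` is measurable and compact-valued. -/
structure G4 [TopologicalSpace 𝒰] : Prop where
  measurable : MeasurableMultifunction D.U
  compact : ∀ x, IsCompact (D.U x)

end Model

/-- (G2): the multifunction `(x, m) ↦ 𝓐(x, m)` is lower semicontinuous, for the given topology of `X`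
and the weak* topology of `𝓜`. -/
def G2 [TopologicalSpace X] {p : ℝ≥0∞} {P₀ : Measure X}
    (σ : Lp ℝ p P₀ → X → DualProb p P₀ → ℝ) : Prop :=
  LowerSemicontMultifunction fun z : X × DualProb p P₀ => subdiff σ z.1 z.2

/-! ### Markov conditional risk measures and the nested risk of a policy -/

namespace Model

variable {D : Model X 𝒰} {p : ℝ≥0∞} {P₀ : Measure X}

/-- Under (G0), the measure `Q(x, u)` as an element of `𝓜`. -/
def kernelM (h0 : D.G0 p P₀) (z : D.Graph) : DualProb p P₀ :=
  ⟨D.Q z, D.Q_markov.isProbabilityMeasure z, h0 z⟩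

/-- The section `y ↦ Z(hₙ, πₙ(hₙ), y)` of a function of the history up to stage `n + 1`. -/
def sect (π : D.Policy) (n : ℕ) (Z : D.Hist (n + 1) → ℝ) (h : D.Hist n) : X → ℝ :=
  fun y => Z (h.append (π.rule n h) (π.feasible n h) y)

/-- The one-step conditional risk measure
`ρₙ(Z)(hₙ) = σ(Z(hₙ, πₙ(hₙ), ·), xₙ, Q(xₙ, πₙ(hₙ)))`. -/
def condRisk (h0 : D.G0 p P₀) (σ : Lp ℝ p P₀ → X → DualProb p P₀ → ℝ) (π : D.Policy)
    (n : ℕ) (Z : D.Hist (n + 1) → ℝ) : D.Hist n → ℝ :=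
  fun h => σ (toV p P₀ (sect π n Z h)) h.2 (kernelM h0 ⟨(h.2, π.rule n h), π.feasible n h⟩)

/-- The nested risk of the costs of the `k` stages `n, …, n + k - 1` and of the terminal cost `g`:
`ρₙ(c(xₙ,uₙ,xₙ₊₁) + ρₙ₊₁(c(xₙ₊₁,uₙ₊₁,xₙ₊₂) + ⋯ + ρₙ₊ₖ₋₁(c(xₙ₊ₖ₋₁,uₙ₊ₖ₋₁,xₙ₊ₖ) + g(xₙ₊ₖ)) ⋯ ))`. -/
def nestedRisk (h0 : D.G0 p P₀) (σ : Lp ℝ p P₀ → X → DualProb p P₀ → ℝ) (g : X → ℝ)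
    (π : D.Policy) : (k n : ℕ) → D.Hist n → ℝ
  | 0, _ => fun h => g h.2
  | k + 1, n => condRisk h0 σ π n fun h => lastCost h + nestedRisk h0 σ g π k (n + 1) h

/-- The objective `J_T(Π, x)` of the finite-horizon problem. -/
def J (h0 : D.G0 p P₀) (σ : Lp ℝ p P₀ → X → DualProb p P₀ → ℝ) (g : X → ℝ) (T : ℕ)
    (π : D.Policy) (x : X) : ℝ :=
  nestedRisk h0 σ g π T 0 (Fin.elim0, x)

/-- The expression `J_T(Π, ·)` is well defined: at every stage `n < T` the argument of the one-step
conditional risk measure is, after every history, a function of the next state that belongs to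
`𝓛_p(X, P₀)`. -/
def WellDefined (h0 : D.G0 p P₀) (σ : Lp ℝ p P₀ → X → DualProb p P₀ → ℝ) (g : X → ℝ) (T : ℕ)
    (π : D.Policy) : Prop :=
  ∀ k n : ℕ, n + k + 1 = T → ∀ h : D.Hist n,
    MemLp (sect π n (fun h' => lastCost h' + nestedRisk h0 σ g π k (n + 1) h') h) p P₀

/-- The policy `π` solves the finite-horizon problem, for every initial state. -/
def IsOptimal (h0 : D.G0 p P₀) (σ : Lp ℝ p P₀ → X → DualProb p P₀ → ℝ) (g : X → ℝ) (T : ℕ)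
    (π : D.Policy) : Prop :=
  WellDefined h0 σ g T π ∧
    ∀ x, ∀ π' : D.Policy, WellDefined h0 σ g T π' → J h0 σ g T π x ≤ J h0 σ g T π' x

/-! ### Dynamic programming equations -/

/-- `σ(c(x, u, ·) + v(·), x, Q(x, u))` for `(x, u)` in the graph of `U`. -/
def dpValue (h0 : D.G0 p P₀) (σ : Lp ℝ p P₀ → X → DualProb p P₀ → ℝ) (v : X → ℝ)
    (z : D.Graph) : ℝ :=
  σ (toV p P₀ fun y => D.c z.1.1 z.1.2 y + v y) z.1.1 (kernelM h0 z)

/-- The functions `v₀, …, v_T` satisfy the dynamic programming equations with terminal function `g`: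
`v_T = g` and `vₙ(x) = min_{u ∈ U(x)} σ(c(x,u,·) + vₙ₊₁, x, Q(x,u))` for `n < T`. -/
def SolvesDP (h0 : D.G0 p P₀) (σ : Lp ℝ p P₀ → X → DualProb p P₀ → ℝ) (g : X → ℝ) (T : ℕ)
    (v : ℕ → X → ℝ) : Prop :=
  v T = g ∧ ∀ n < T, ∀ x,
    IsLeast {r : ℝ | ∃ (u : 𝒰) (hu : u ∈ D.U x), r = dpValue h0 σ (v (n + 1)) ⟨(x, u), hu⟩} (v n x)

/-- The decision rules of `π` at the stages `n < T` attain the minima in the dynamic programming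
equations. -/
def IsArgmin (h0 : D.G0 p P₀) (σ : Lp ℝ p P₀ → X → DualProb p P₀ → ℝ) (T : ℕ)
    (v : ℕ → X → ℝ) (π : D.MarkovPolicy) : Prop :=
  ∀ n < T, ∀ x, ∀ (u : 𝒰) (hu : u ∈ D.U x),
    dpValue h0 σ (v (n + 1)) ⟨(x, π.rule n x), π.feasible n x⟩ ≤
      dpValue h0 σ (v (n + 1)) ⟨(x, u), hu⟩

end Model

end

end RiskMDP

/-!
Dynamic programming for Markov risk measures on `L_p`.

The heart of the matter is that, for `v ∈ L_p`, the minimum over `u ∈ U(x)` of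
`F(x, u) = σ(c(x, u, ·) + v, x, Q(x, u))` is attained by a measurable decision rule.

By the Hahn–Banach theorem and the Riesz representation of positive functionals on `L_p`
(`exists_dualProb_eq_integral`), a coherent measure of risk is the maximum of the integrals with
respect to the measures in its subdifferential at `0` (`IsCoherent.exists_integral_eq`).  With the
weak* continuity of `Q`, the lower semicontinuity of the subdifferential and that of the cost, this
yields lower semicontinuity of `F` on each of the pieces `{w ≤ N}` of the graph of `U`
(`Model.dpValue_le_of_tendsto`).  On the whole graph `F` need not be lower semicontinuous: the
weight `w` may be unbounded near a point, and the costs are dominated only in terms of `w`.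

The pieces suffice.  Each section of the graph over a point `x` lies in one piece, so that minima
over the compact sets `U(x)` are attained, and countably many pieces cover the graph, so that sets of the
form `{x | ∃ u ∈ U(x) ∩ C, F(x, u) ≤ r}` with `C` closed are measurable.  A lexicographic
minimization then selects a minimizer measurably
(`MeasurableMultifunction.exists_measurable_argmin`).

Iterating backwards gives the value functions `vₙ` and a Markov policy attaining the minima.  Its
nested risk is `vₙ` (`Model.nestedRisk_markov_eq`), and `vₙ ∈ L_p` for `n ≥ 1` because the objective
is well defined for Markov policies.  Monotonicity of `σ` makes `vₙ` a lower bound for the nested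
risk of every policy (`Model.le_nestedRisk`).
-/

namespace RiskMDP

noncomputable section

/-! ### Positive linear functionals on `L_p` -/

section PositiveFunctionals

variable {X : Type*} [MeasurableSpace X] {p : ℝ≥0∞} {P₀ : Measure X}

lemma Lp_smul_nonneg {a : ℝ} (ha : 0 ≤ a) {φ : Lp ℝ p P₀} (hφ : 0 ≤ φ) : 0 ≤ a • φ := by
  rw [← Lp.coeFn_nonneg] at hφ ⊢
  filter_upwards [hφ, Lp.coeFn_smul a φ] with y h1 h2
  rw [h2]
  exact mul_nonneg ha h1

/-- A positive linear functional on `L_p` is bounded: otherwise a norm-convergent series of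
nonnegative functions would have a sum with infinite value. -/
lemma exists_bound_of_nonneg [Fact (1 ≤ p)] (f : Lp ℝ p P₀ →ₗ[ℝ] ℝ)
    (hf : ∀ φ, 0 ≤ φ → 0 ≤ f φ) : ∃ M : ℝ, 0 ≤ M ∧ ∀ φ, |f φ| ≤ M * ‖φ‖ := by
  have hmono : ∀ φ ψ, φ ≤ ψ → f φ ≤ f ψ := fun φ ψ h => by
    have := hf (ψ - φ) (sub_nonneg.2 h)
    rw [map_sub] at this
    linarith
  obtain ⟨M, hM0, hM⟩ : ∃ M : ℝ, 0 ≤ M ∧ ∀ φ, 0 ≤ φ → f φ ≤ M * ‖φ‖ := by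
    by_contra! hcon
    -- `4 ^ n` leaves a factor `2 ^ n` after `φ n` is rescaled to the norm `2 ^ (-n)`
    choose φ hφ0 hφ using fun n : ℕ => hcon ((4 : ℝ) ^ n) (by positivity)
    have hpos : ∀ n, 0 < ‖φ n‖ := fun n => by
      rw [norm_pos_iff]
      intro h
      have := hφ n
      simp [h] at this
    let ψ : ℕ → Lp ℝ p P₀ := fun n => (‖φ n‖⁻¹ * (1 / 2) ^ n) • φ n
    have hψ0 : ∀ n, 0 ≤ ψ n := fun n =>
      Lp_smul_nonneg (mul_nonneg (inv_nonneg.2 (norm_nonneg _)) (by positivity)) (hφ0 n)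
    have hψn : ∀ n, ‖ψ n‖ = (1 / 2) ^ n := fun n => by
      have := (hpos n).ne'
      simp only [ψ, norm_smul, norm_mul, norm_inv, norm_norm, norm_pow]
      rw [Real.norm_of_nonneg (by norm_num : (0 : ℝ) ≤ 1 / 2)]
      field_simp
    have hψs : Summable ψ := by
      refine Summable.of_norm ?_
      simp only [hψn]
      exact summable_geometric_two
    have hlow : ∀ n : ℕ, (2 : ℝ) ^ n ≤ f (∑' i, ψ i) := fun n => by
      have h1 : f (ψ n) ≤ f (∑' i, ψ i) := hmono _ _ (hψs.le_tsum n fun j _ => hψ0 j)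
      refine le_trans ?_ h1
      simp only [ψ, map_smul, smul_eq_mul]
      have h2 := (hφ n).le
      have h3 : (2 : ℝ) ^ n = (‖φ n‖⁻¹ * (1 / 2) ^ n) * (4 ^ n * ‖φ n‖) := by
        have := (hpos n).ne'
        have h4 : (4 : ℝ) ^ n = 2 ^ n * 2 ^ n := by rw [← mul_pow]; norm_num
        have h5 : (2 : ℝ) ^ n * (1 / 2) ^ n = 1 := by rw [← mul_pow]; norm_num
        rw [h4]
        field_simp
        linarith
      rw [h3]
      exact mul_le_mul_of_nonneg_left h2 (by positivity)
    obtain ⟨n, hn⟩ := pow_unbounded_of_one_lt (f (∑' i, ψ i)) (one_lt_two : (1 : ℝ) < 2)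
    exact absurd (hlow n) (not_le.2 hn)
  refine ⟨M, hM0, fun φ => abs_le.2 ⟨?_, ?_⟩⟩
  · have h1 := hM |φ| (abs_nonneg φ)
    have h2 := hmono (-|φ|) φ (neg_le.1 (neg_le_abs φ))
    rw [norm_abs_eq_norm] at h1
    rw [map_neg] at h2
    linarith
  · have h1 := hM |φ| (abs_nonneg φ)
    have h2 := hmono φ |φ| (le_abs_self φ)
    rw [norm_abs_eq_norm] at h1
    linarith

variable [Fact (1 ≤ p)] [IsProbabilityMeasure P₀]

/-- The measure `B ↦ f (1_B)` of a positive linear functional `f` on `L_p`. -/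
lemma exists_measure_of_nonneg (hp : p ≠ ∞) (f : Lp ℝ p P₀ →ₗ[ℝ] ℝ)
    (hf : ∀ φ, 0 ≤ φ → 0 ≤ f φ) :
    ∃ m : Measure X, ∀ (B : Set X) (hB : MeasurableSet B),
      m B = ENNReal.ofReal (f (indicatorConstLp p hB (measure_ne_top P₀ B) 1)) := by
  obtain ⟨M, hM0, hM⟩ := exists_bound_of_nonneg f hf
  have hcont : Continuous f := AddMonoidHomClass.continuous_of_bound f M hM
  have hnn : ∀ (B : Set X) (hB : MeasurableSet B),
      0 ≤ f (indicatorConstLp p hB (measure_ne_top P₀ B) 1) := fun B hB => by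
    apply hf
    rw [← Lp.coeFn_nonneg]
    filter_upwards [indicatorConstLp_coeFn (p := p) (hs := hB) (hμs := measure_ne_top P₀ B)
      (c := (1 : ℝ))] with y hy
    rw [hy]
    exact indicator_nonneg (fun _ _ => zero_le_one) y
  refine ⟨Measure.ofMeasurable
    (fun B hB => ENNReal.ofReal (f (indicatorConstLp p hB (measure_ne_top P₀ B) 1)))
    (by simp [indicatorConstLp_empty]) ?_, fun B hB => Measure.ofMeasurable_apply B hB⟩
  intro B hB hd
  have hA : ∀ n, MeasurableSet (⋃ i ∈ Finset.range n, B i) := fun n =>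
    Finset.measurableSet_biUnion _ fun i _ => hB i
  have hsum : ∀ n, f (indicatorConstLp p (hA n) (measure_ne_top P₀ _) 1) =
      ∑ i ∈ Finset.range n, f (indicatorConstLp p (hB i) (measure_ne_top P₀ (B i)) 1) := by
    intro n
    induction n with
    | zero => simp [indicatorConstLp_empty]
    | succ n ih =>
      rw [Finset.sum_range_succ, ← ih, ← map_add,
        ← indicatorConstLp_disjoint_union (hA n) (hB n) (measure_ne_top P₀ _)
          (measure_ne_top P₀ _)]
      · congr 2
        rw [Finset.range_add_one, Finset.set_biUnion_insert, union_comm]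
      · rw [disjoint_iUnion₂_left]
        intro i hi
        exact hd (Finset.mem_range.1 hi).ne
  have hlim : Tendsto (fun n => f (indicatorConstLp p (hA n) (measure_ne_top P₀ _) (1 : ℝ))) atTop
      (𝓝 (f (indicatorConstLp p (MeasurableSet.iUnion hB) (measure_ne_top P₀ _) 1))) := by
    refine (hcont.tendsto _).comp (tendsto_indicatorConstLp_set hp ?_)
    have hsub : ∀ n, (⋃ i ∈ Finset.range n, B i) ⊆ ⋃ i, B i := fun n =>
      iUnion₂_subset fun i _ => subset_iUnion B i
    have heq : ∀ n, P₀ (symmDiff (⋃ i ∈ Finset.range n, B i) (⋃ i, B i)) =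
        P₀ ((⋃ i, B i) \ ⋃ i ∈ Finset.range n, B i) := fun n => by
      rw [Set.symmDiff_def, sdiff_eq_empty.2 (hsub n), empty_union]
    simp only [heq]
    have h0 : P₀ (⋂ n, (⋃ i, B i) \ ⋃ i ∈ Finset.range n, B i) = 0 := by
      convert measure_empty (μ := P₀)
      rw [eq_empty_iff_forall_notMem]
      intro y hy
      rw [mem_iInter] at hy
      obtain ⟨i, hi⟩ := mem_iUnion.1 (hy 0).1
      exact (hy (i + 1)).2 (mem_iUnion₂.2 ⟨i, by simp, hi⟩)
    rw [← h0]
    refine tendsto_measure_iInter_atTop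
      (fun n => ((MeasurableSet.iUnion hB).diff (hA n)).nullMeasurableSet) ?_
      ⟨0, measure_ne_top _ _⟩
    intro a b hab
    refine sdiff_subset_sdiff_right (biUnion_subset_biUnion_left ?_)
    intro i hi
    simp only [Finset.coe_range, mem_Iio] at hi ⊢
    exact lt_of_lt_of_le hi hab
  have hS : HasSum (fun i => f (indicatorConstLp p (hB i) (measure_ne_top P₀ (B i)) 1))
      (f (indicatorConstLp p (MeasurableSet.iUnion hB) (measure_ne_top P₀ _) 1)) := by
    rw [hasSum_iff_tendsto_nat_of_nonneg fun i => hnn _ _]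
    simpa only [hsum] using hlim
  rw [← hS.tsum_eq, ENNReal.ofReal_tsum_of_nonneg (fun i => hnn _ _) hS.summable]

/-- A measure `m` satisfying `∫ φ dm ≤ M ‖φ‖_p` for all nonnegative `φ` has a density in the dual
space `L_q`.  For `p > 1` this is seen by testing with the powers `(g ∧ n) ^ (q - 1)` of the
truncated density `g`. -/
lemma memLp_rnDeriv_of_lintegral_le (hp : p ≠ ∞) {m : Measure X} [IsFiniteMeasure m]
    (hac : m ≪ P₀) {M : ℝ≥0∞} (hMtop : M ≠ ∞)
    (hM : ∀ φ : X → ℝ≥0∞, Measurable φ →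
      ∫⁻ y, φ y ∂m ≤ M * (∫⁻ y, φ y ^ p.toReal ∂P₀) ^ (1 / p.toReal)) :
    MemLp (fun y => (m.rnDeriv P₀ y).toReal) (ENNReal.conjExponent p) P₀ := by
  have hp1 : 1 ≤ p := Fact.out
  have hgm := Measure.measurable_rnDeriv m P₀
  rcases hp1.eq_or_lt with rfl | hp1
  · have hle : m.rnDeriv P₀ ≤ᵐ[P₀] fun _ => M := by
      refine ae_le_of_forall_setLIntegral_le_of_sigmaFinite hgm fun s hs _ => ?_
      have h := hM (s.indicator 1) (measurable_one.indicator hs)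
      rw [lintegral_indicator_one hs, ENNReal.toReal_one] at h
      simp only [ENNReal.rpow_one, div_one] at h
      rw [lintegral_indicator_one hs] at h
      rw [Measure.setLIntegral_rnDeriv hac]
      simpa using h
    refine (memLp_top_of_bound hgm.ennreal_toReal.aestronglyMeasurable M.toReal ?_).mono_exponent
      le_top
    filter_upwards [hle] with y hy
    rw [Real.norm_of_nonneg ENNReal.toReal_nonneg]
    exact ENNReal.toReal_mono hMtop hy
  · have hpr : 1 < p.toReal := by
      rw [← ENNReal.toReal_one]
      exact (ENNReal.toReal_lt_toReal (by simp) hp).2 hp1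
    obtain ⟨r, hr⟩ : ∃ r, r = p.toReal := ⟨_, rfl⟩
    rw [← hr] at hpr hM
    have hconj : ENNReal.conjExponent p = ENNReal.ofReal (Real.conjExponent r) := by
      lift p to NNReal using hp
      have hp1' : 1 < p := by exact_mod_cast hp1
      rw [ENNReal.coe_toReal] at hr
      have : Real.conjExponent r = (NNReal.conjExponent p : ℝ) := by
        rw [hr, Real.conjExponent, NNReal.conjExponent, NNReal.coe_div, NNReal.coe_sub hp1'.le,
          NNReal.coe_one]
      rw [← ENNReal.coe_conjExponent hp1', this, ENNReal.ofReal_coe_nnreal]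
    have hcr := Real.HolderConjugate.conjExponent hpr
    obtain ⟨q, hq⟩ : ∃ q, q = Real.conjExponent r := ⟨_, rfl⟩
    rw [← hq] at hconj hcr
    rw [hconj]
    have hq1 : 1 < q := hcr.symm.lt
    have hr0 : 0 < r := by linarith
    have hq0 : 0 < q := by linarith
    -- the bound for the truncations
    have key : ∀ n : ℕ, ∫⁻ y, (min (m.rnDeriv P₀ y) n) ^ q ∂P₀ ≤ M ^ q := by
      intro n
      set G : X → ℝ≥0∞ := fun y => min (m.rnDeriv P₀ y) n with hG
      have hGm : Measurable G := hgm.min measurable_const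
      have hGn : ∀ y, G y ≠ ∞ := fun y => ((min_le_right _ _).trans_lt (by simp)).ne
      set I := ∫⁻ y, G y ^ q ∂P₀ with hI
      have hIfin : I ≠ ∞ := by
        have : I ≤ ∫⁻ _, (n : ℝ≥0∞) ^ q ∂P₀ :=
          lintegral_mono fun y => ENNReal.rpow_le_rpow (min_le_right _ _) hq0.le
        refine (this.trans_lt ?_).ne
        rw [lintegral_const, measure_univ, mul_one]
        exact ENNReal.rpow_lt_top_of_nonneg hq0.le (by simp)
      have h1 : I ≤ M * I ^ (1 / r) := by
        calc I ≤ ∫⁻ y, m.rnDeriv P₀ y * G y ^ (q - 1) ∂P₀ := by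
              refine lintegral_mono fun y => ?_
              have : G y ^ q = G y * G y ^ (q - 1) := by
                conv_lhs => rw [show q = 1 + (q - 1) by ring]
                rw [ENNReal.rpow_add_of_nonneg _ _ zero_le_one (by linarith), ENNReal.rpow_one]
              rw [this]
              gcongr
              exact min_le_left _ _
          _ = ∫⁻ y, G y ^ (q - 1) ∂m :=
              lintegral_rnDeriv_mul hac (hGm.pow_const _).aemeasurable
          _ ≤ M * (∫⁻ y, (G y ^ (q - 1)) ^ r ∂P₀) ^ (1 / r) := hM _ (hGm.pow_const _)
          _ = M * I ^ (1 / r) := by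
              congr 2
              refine lintegral_congr fun y => ?_
              rw [← ENNReal.rpow_mul]
              congr 1
              exact hcr.symm.sub_one_mul_conj
      rcases eq_or_ne I 0 with h0 | h0
      · rw [h0]; exact zero_le
      have h2 : I = I ^ (1 / q) * I ^ (1 / r) := by
        rw [← ENNReal.rpow_add _ _ h0 hIfin]
        have : 1 / q + 1 / r = 1 := by
          have := hcr.symm.inv_add_inv_eq_one
          simpa using this
        rw [this, ENNReal.rpow_one]
      have h3 : I ^ (1 / q) ≤ M := by
        have hx0 : I ^ (1 / r) ≠ 0 := by
          rw [Ne, ENNReal.rpow_eq_zero_iff]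
          simp [h0, hIfin]
        have hxt : I ^ (1 / r) ≠ ∞ := ENNReal.rpow_ne_top_of_nonneg (by positivity) hIfin
        rw [← ENNReal.mul_le_mul_iff_left hx0 hxt, ← h2]
        exact h1
      calc I = (I ^ (1 / q)) ^ q := by
            rw [← ENNReal.rpow_mul, one_div, inv_mul_cancel₀ hq0.ne', ENNReal.rpow_one]
        _ ≤ M ^ q := ENNReal.rpow_le_rpow h3 hq0.le
    have hall : ∫⁻ y, (m.rnDeriv P₀ y) ^ q ∂P₀ ≤ M ^ q := by
      have hsup : ∀ y, (m.rnDeriv P₀ y) ^ q = ⨆ n : ℕ, (min (m.rnDeriv P₀ y) n) ^ q := fun y => by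
        refine (tendsto_nhds_unique (tendsto_atTop_iSup ?_) ?_).symm
        · intro a b hab
          exact ENNReal.rpow_le_rpow (min_le_min_left _ (by exact_mod_cast hab)) hq0.le
        · refine ((ENNReal.continuous_rpow_const (y := q)).tendsto _).comp ?_
          have := (tendsto_const_nhds (x := m.rnDeriv P₀ y)).min ENNReal.tendsto_nat_nhds_top
          simpa using this
      simp only [hsup]
      rw [lintegral_iSup (fun n => (hgm.min measurable_const).pow_const q)]
      · exact iSup_le key
      · intro a b hab y
        exact ENNReal.rpow_le_rpow (min_le_min_left _ (by exact_mod_cast hab)) hq0.le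
    refine ⟨hgm.ennreal_toReal.aestronglyMeasurable, ?_⟩
    rw [eLpNorm_eq_lintegral_rpow_enorm_toReal (by simpa using hq0) (by simp),
      ENNReal.toReal_ofReal hq0.le]
    refine ENNReal.rpow_lt_top_of_nonneg (by positivity) ?_
    have hle : ∫⁻ y, ‖(m.rnDeriv P₀ y).toReal‖ₑ ^ q ∂P₀ ≤ M ^ q := by
      refine (lintegral_mono fun y => ?_).trans hall
      refine ENNReal.rpow_le_rpow ?_ hq0.le
      rw [Real.enorm_of_nonneg ENNReal.toReal_nonneg]
      exact ENNReal.ofReal_toReal_le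
    exact (hle.trans_lt (ENNReal.rpow_lt_top_of_nonneg hq0.le hMtop)).ne


end PositiveFunctionals

/-! ### Riesz representation of positive functionals -/

section Duality

variable {X : Type*} [MeasurableSpace X] {p : ℝ≥0∞} {P₀ : Measure X}
  [IsProbabilityMeasure P₀]

/-- If `m B = f (1_B)` for all measurable `B`, then `m` represents `f` on nonnegative simple
functions. -/
lemma lintegral_simpleFunc_eq {f : Lp ℝ p P₀ →ₗ[ℝ] ℝ} (hf : ∀ φ, 0 ≤ φ → 0 ≤ f φ) {m : Measure X}
    (hm : ∀ (B : Set X) (hB : MeasurableSet B),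
      m B = ENNReal.ofReal (f (indicatorConstLp p hB (measure_ne_top P₀ B) 1)))
    (s : SimpleFunc X NNReal) :
    ∀ hs : MemLp (fun y => (s y : ℝ)) p P₀,
      ∫⁻ y, s y ∂m = ENNReal.ofReal (f (hs.toLp _)) := by
  have hpos : ∀ (s : SimpleFunc X NNReal) (hs : MemLp (fun y => (s y : ℝ)) p P₀),
      0 ≤ f (hs.toLp _) := fun s hs => by
    apply hf
    rw [← Lp.coeFn_nonneg]
    filter_upwards [hs.coeFn_toLp] with y hy
    rw [hy]
    exact NNReal.coe_nonneg _
  induction s using SimpleFunc.induction with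
  | const c hB =>
    rename_i B
    intro hs
    have h1 : hs.toLp _ = (c : ℝ) • indicatorConstLp p hB (measure_ne_top P₀ B) (1 : ℝ) := by
      apply Lp.ext
      filter_upwards [hs.coeFn_toLp, Lp.coeFn_smul (c : ℝ)
        (indicatorConstLp p hB (measure_ne_top P₀ B) (1 : ℝ)),
        indicatorConstLp_coeFn (p := p) (hs := hB) (hμs := measure_ne_top P₀ B)
          (c := (1 : ℝ))] with y h1 h2 h3
      rw [h1, h2, Pi.smul_apply, h3]
      by_cases hy : y ∈ B <;> simp [hy]
    have h2 : ∀ y, ((SimpleFunc.piecewise B hB (SimpleFunc.const X c) (SimpleFunc.const X 0) y :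
        NNReal) : ℝ≥0∞) = B.indicator (fun _ => (c : ℝ≥0∞)) y := fun y => by
      by_cases hy : y ∈ B <;> simp [hy]
    rw [h1, map_smul, smul_eq_mul, ENNReal.ofReal_mul (NNReal.coe_nonneg c), ← hm B hB,
      lintegral_congr h2, lintegral_indicator_const hB, ENNReal.ofReal_coe_nnreal]
  | add hd h1 h2 =>
    rename_i s t
    intro hst
    have hs : MemLp (fun y => (s y : ℝ)) p P₀ :=
      (s.map ((↑) : NNReal → ℝ)).memLp_of_isFiniteMeasure p P₀
    have ht : MemLp (fun y => (t y : ℝ)) p P₀ :=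
      (t.map ((↑) : NNReal → ℝ)).memLp_of_isFiniteMeasure p P₀
    have h3 : hst.toLp _ = hs.toLp _ + ht.toLp _ := by
      rw [← MemLp.toLp_add]
      exact MemLp.toLp_congr _ _ (ae_of_all _ fun y => by simp)
    have h4 : ∀ y, ((s + t) y : ℝ≥0∞) = (s y : ℝ≥0∞) + t y := fun y => by simp
    rw [h3, map_add, ENNReal.ofReal_add (hpos _ _) (hpos _ _), ← h1 hs, ← h2 ht,
      lintegral_congr h4, lintegral_add_left (by fun_prop)]

variable [Fact (1 ≤ p)]

lemma DualProb.integrable (m : DualProb p P₀) {φ : X → ℝ} (hφ : MemLp φ p P₀) :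
    Integrable φ m.1 := by
  have := m.2.1
  rw [← integrable_rnDeriv_smul_iff m.2.2.1]
  exact m.2.2.2.integrable_mul hφ

lemma DualProb.integrable_coeFn (m : DualProb p P₀) (φ : Lp ℝ p P₀) :
    Integrable φ m.1 :=
  m.integrable (Lp.memLp φ)

/-- Integration against an element of `𝓜`, as a linear functional on `L_p`. -/
def DualProb.integralₗ (m : DualProb p P₀) : Lp ℝ p P₀ →ₗ[ℝ] ℝ where
  toFun φ := ∫ y, φ y ∂m.1
  map_add' φ ψ := by
    rw [integral_congr_ae (m.2.2.1.ae_le (Lp.coeFn_add φ ψ))]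
    exact integral_add (m.integrable_coeFn φ) (m.integrable_coeFn ψ)
  map_smul' a φ := by
    rw [integral_congr_ae (m.2.2.1.ae_le (Lp.coeFn_smul a φ))]
    exact integral_smul a _

lemma DualProb.continuous_integral (m : DualProb p P₀) :
    Continuous fun φ : Lp ℝ p P₀ => ∫ y, φ y ∂m.1 := by
  obtain ⟨M, -, hM⟩ := exists_bound_of_nonneg m.integralₗ fun φ hφ =>
    integral_nonneg_of_ae (m.2.2.1.ae_le ((Lp.coeFn_nonneg φ).2 hφ))
  exact AddMonoidHomClass.continuous_of_bound m.integralₗ M hM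

/-- Riesz representation: a normalized positive linear functional on `L_p`, `p < ∞`, is the
integral with respect to a probability measure in the dual space. -/
theorem exists_dualProb_eq_integral (hp : p ≠ ∞) (f : Lp ℝ p P₀ →ₗ[ℝ] ℝ)
    (hf : ∀ φ, 0 ≤ φ → 0 ≤ f φ) (hf1 : f (Lp.const p P₀ 1) = 1) :
    ∃ m : DualProb p P₀, ∀ φ : Lp ℝ p P₀, ∫ y, φ y ∂m.1 = f φ := by
  obtain ⟨M, hM0, hM⟩ := exists_bound_of_nonneg f hf
  obtain ⟨m, hm⟩ := exists_measure_of_nonneg hp f hf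
  have hp0 : p ≠ 0 := (zero_lt_one.trans_le (Fact.out : 1 ≤ p)).ne'
  have hprob : IsProbabilityMeasure m := ⟨by
    rw [hm _ MeasurableSet.univ, indicatorConstLp_univ, hf1, ENNReal.ofReal_one]⟩
  have hac : m ≪ P₀ := by
    refine Measure.AbsolutelyContinuous.mk fun B hB h0 => ?_
    have : indicatorConstLp p hB (measure_ne_top P₀ B) (1 : ℝ) = 0 := by
      rw [← norm_eq_zero, norm_indicatorConstLp hp0 hp, measureReal_def, h0]
      have : p.toReal ≠ 0 := (ENNReal.toReal_pos hp0 hp).ne'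
      simp [this]
    rw [hm B hB, this, map_zero, ENNReal.ofReal_zero]
  have hbound : ∀ φ : X → ℝ≥0∞, Measurable φ →
      ∫⁻ y, φ y ∂m ≤ ENNReal.ofReal M * (∫⁻ y, φ y ^ p.toReal ∂P₀) ^ (1 / p.toReal) := by
    intro φ _
    rw [lintegral_eq_nnreal]
    refine iSup₂_le fun s hsφ => ?_
    have hs : MemLp (fun y => (s y : ℝ)) p P₀ :=
      (s.map ((↑) : NNReal → ℝ)).memLp_of_isFiniteMeasure p P₀
    rw [← SimpleFunc.lintegral_eq_lintegral]
    calc ∫⁻ y, (s.map ((↑) : NNReal → ℝ≥0∞)) y ∂m = ENNReal.ofReal (f (hs.toLp _)) :=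
          lintegral_simpleFunc_eq hf hm s hs
      _ ≤ ENNReal.ofReal (M * ‖hs.toLp _‖) :=
          ENNReal.ofReal_le_ofReal ((le_abs_self _).trans (hM _))
      _ = ENNReal.ofReal M * eLpNorm (fun y => (s y : ℝ)) p P₀ := by
          rw [ENNReal.ofReal_mul hM0, Lp.norm_toLp, ENNReal.ofReal_toReal hs.2.ne]
      _ ≤ ENNReal.ofReal M * (∫⁻ y, φ y ^ p.toReal ∂P₀) ^ (1 / p.toReal) := by
          rw [eLpNorm_eq_lintegral_rpow_enorm_toReal hp0 hp]
          gcongr with y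
          refine le_trans (le_of_eq ?_) (hsφ y)
          simp
  have hdual : InDual p P₀ m :=
    ⟨hac, memLp_rnDeriv_of_lintegral_le hp hac ENNReal.ofReal_ne_top hbound⟩
  let m' : DualProb p P₀ := ⟨m, hprob, hdual⟩
  have hcf : Continuous f := AddMonoidHomClass.continuous_of_bound f M hM
  refine ⟨m', fun φ => ?_⟩
  induction φ using Lp.induction hp with
  | indicatorConst c hB hlt =>
    rename_i B
    have h1 : (Lp.simpleFunc.indicatorConst p hB hlt.ne c : Lp ℝ p P₀) =
        c • indicatorConstLp p hB (measure_ne_top P₀ B) (1 : ℝ) := by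
      rw [Lp.simpleFunc.coe_indicatorConst]
      apply Lp.ext
      filter_upwards [indicatorConstLp_coeFn (p := p) (hs := hB) (hμs := hlt.ne) (c := c),
        Lp.coeFn_smul c (indicatorConstLp p hB (measure_ne_top P₀ B) (1 : ℝ)),
        indicatorConstLp_coeFn (p := p) (hs := hB) (hμs := measure_ne_top P₀ B)
          (c := (1 : ℝ))] with y h1 h2 h3
      rw [h1, h2, Pi.smul_apply, h3]
      by_cases hy : y ∈ B <;> simp [hy]
    have h2 : ∫ y, (indicatorConstLp p hB (measure_ne_top P₀ B) (1 : ℝ)) y ∂m =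
        f (indicatorConstLp p hB (measure_ne_top P₀ B) 1) := by
      rw [integral_congr_ae (hac.ae_le indicatorConstLp_coeFn), integral_indicator hB]
      have h3 : 0 ≤ f (indicatorConstLp p hB (measure_ne_top P₀ B) 1) := by
        apply hf
        rw [← Lp.coeFn_nonneg]
        filter_upwards [indicatorConstLp_coeFn (p := p) (hs := hB) (hμs := measure_ne_top P₀ B)
          (c := (1 : ℝ))] with y hy
        rw [hy]
        exact indicator_nonneg (fun _ _ => zero_le_one) y
      simp [measureReal_def, hm B hB, ENNReal.toReal_ofReal h3]
    rw [h1, map_smul, ← h2]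
    exact m'.integralₗ.map_smul c _
  | add hφ hψ _ h1 h2 =>
    rw [map_add, ← h1, ← h2]
    exact m'.integralₗ.map_add _ _
  | isClosed => exact isClosed_eq m'.continuous_integral hcf

end Duality

/-! ### Dual representation of coherent measures of risk -/

section Coherent

variable {X : Type*} [MeasurableSpace X] {p : ℝ≥0∞} {P₀ : Measure X}
  [IsProbabilityMeasure P₀]

lemma IsCoherent.map_zero {ρ : Lp ℝ p P₀ → ℝ} (h : IsCoherent ρ) : ρ 0 = 0 := by
  simpa using h.homogeneous 0 0 le_rfl

lemma IsCoherent.add_le {ρ : Lp ℝ p P₀ → ℝ} (h : IsCoherent ρ) (φ ψ : Lp ℝ p P₀) :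
    ρ (φ + ψ) ≤ ρ φ + ρ ψ := by
  have h1 := h.convex (1 / 2) ((2 : ℝ) • φ) ((2 : ℝ) • ψ) (by norm_num) (by norm_num)
  rw [h.homogeneous 2 φ (by norm_num), h.homogeneous 2 ψ (by norm_num), smul_smul, smul_smul] at h1
  norm_num at h1
  linarith

/-- Dual representation: the value of a coherent risk measure at `φ` is the integral of `φ` with
respect to a measure in the subdifferential at `0`.  The Hahn–Banach theorem extends the functional
`t φ ↦ t ρ(φ)` to a linear one dominated by `ρ`, which is positive and normalized because `ρ` is
monotone and translation-equivariant. -/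
theorem IsCoherent.exists_integral_eq [Fact (1 ≤ p)] (hp : p ≠ ∞) {ρ : Lp ℝ p P₀ → ℝ}
    (h : IsCoherent ρ) (φ : Lp ℝ p P₀) :
    ∃ m : DualProb p P₀, (∀ ψ : Lp ℝ p P₀, ∫ y, ψ y ∂m.1 ≤ ρ ψ) ∧ ∫ y, φ y ∂m.1 = ρ φ := by
  obtain ⟨f, hfφ, hfρ⟩ : ∃ f : Lp ℝ p P₀ →ₗ[ℝ] ℝ, f φ = ρ φ ∧ ∀ ψ, f ψ ≤ ρ ψ := by
    -- for `c < 0` this is subadditivity, applied to `c φ` and `-c φ`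
    have hsmul : ∀ c : ℝ, c * ρ φ ≤ ρ (c • φ) := fun c => by
      rcases le_total 0 c with hc | hc
      · exact (h.homogeneous c φ hc).ge
      · have h1 := h.add_le (c • φ) ((-c) • φ)
        rw [← add_smul, add_neg_cancel, zero_smul, h.map_zero,
          h.homogeneous (-c) φ (by linarith)] at h1
        linarith
    rcases eq_or_ne φ 0 with h0 | h0
    · obtain ⟨f, -, hf⟩ := exists_extension_of_le_sublinear
        (⟨⊥, 0⟩ : Lp ℝ p P₀ →ₗ.[ℝ] ℝ) ρ (fun c hc ψ => h.homogeneous c ψ hc.le) h.add_le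
        (fun ψ => by
          have : (ψ : Lp ℝ p P₀) = 0 := (Submodule.mem_bot ℝ).1 ψ.2
          rw [this, h.map_zero]
          exact le_rfl)
      exact ⟨f, by rw [h0, _root_.map_zero, h.map_zero], hf⟩
    · obtain ⟨f, hf1, hf⟩ := exists_extension_of_le_sublinear
        (LinearPMap.mkSpanSingleton φ (ρ φ) h0) ρ (fun c hc ψ => h.homogeneous c ψ hc.le) h.add_le
        (by
          rintro ⟨ψ, hψ⟩
          obtain ⟨c, rfl⟩ := Submodule.mem_span_singleton.1 hψ
          exact (LinearPMap.mkSpanSingleton'_apply φ (ρ φ) _ c hψ).trans_le (hsmul c))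
      refine ⟨f, ?_, hf⟩
      have := hf1 ⟨φ, Submodule.mem_span_singleton_self φ⟩
      rw [this]
      exact LinearPMap.mkSpanSingleton_apply ℝ _ h0 (ρ φ)
  have hpos : ∀ ψ, 0 ≤ ψ → 0 ≤ f ψ := fun ψ hψ => by
    have h1 := (hfρ (-ψ)).trans (h.mono (-ψ) 0 (neg_nonpos.2 hψ))
    rw [map_neg, h.map_zero] at h1
    linarith
  have hconst : ∀ a : ℝ, ρ (Lp.const p P₀ a) = a := fun a => by
    simpa [h.map_zero] using h.translation a 0
  have hone : f (Lp.const p P₀ 1) = 1 := by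
    refine le_antisymm ((hfρ _).trans (hconst 1).le) ?_
    have h1 := hfρ (Lp.const p P₀ (-1))
    rw [hconst, map_neg, map_neg] at h1
    linarith
  obtain ⟨m, hm⟩ := exists_dualProb_eq_integral hp f hpos hone
  exact ⟨m, fun ψ => by rw [hm]; exact hfρ ψ, by rw [hm, hfφ]⟩

end Coherent

/-! ### Measurable minimization over compact-valued multifunctions -/

section Selection

variable {X Y : Type*} [TopologicalSpace Y]

/-- The points of `F x` at which `f x` attains its minimum over `F x`. -/
def argminSet (F : X → Set Y) (f : X → Y → ℝ) (x : X) : Set Y :=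
  {u ∈ F x | ∀ u' ∈ F x, f x u ≤ f x u'}

lemma argminSet_nonempty {F : X → Set Y} {f : X → Y → ℝ} (hc : ∀ x, IsCompact (F x))
    (hne : ∀ x, (F x).Nonempty) (hf : ∀ x, LowerSemicontinuousOn (f x) (F x)) (x : X) :
    (argminSet F f x).Nonempty := by
  obtain ⟨u, hu, hmin⟩ := (hf x).exists_isMinOn (hne x) (hc x)
  exact ⟨u, hu, fun u' hu' => hmin hu'⟩

lemma isCompact_argminSet {F : X → Set Y} {f : X → Y → ℝ} (hc : ∀ x, IsCompact (F x))
    (hf : ∀ x, LowerSemicontinuousOn (f x) (F x)) (x : X) : IsCompact (argminSet F f x) := by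
  rcases (argminSet F f x).eq_empty_or_nonempty with h | ⟨u, hu, hmin⟩
  · rw [h]
    exact isCompact_empty
  · obtain ⟨K, hK, hKe⟩ := lowerSemicontinuousOn_iff_preimage_Iic.1 (hf x) (f x u)
    have : argminSet F f x = F x ∩ K := by
      rw [← hKe]
      ext u'
      exact ⟨fun h => ⟨h.1, h.2 u hu⟩, fun h => ⟨h.1, fun z hz => le_trans h.2 (hmin z hz)⟩⟩
    rw [this]
    exact (hc x).inter_right hK

variable [MeasurableSpace X]

/-- A multifunction is closed-measurable if the inverse image `{x | F x ∩ C ≠ ∅}` of every closed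
set `C` is measurable. -/
def ClosedMeasurable (F : X → Set Y) : Prop :=
  ∀ C : Set Y, IsClosed C → MeasurableSet {x | (F x ∩ C).Nonempty}

/-- The minimum value over a compact-valued multifunction is measurable as soon as, for every closed
`C` and every `r`, the set of those `x` for which some `u ∈ F x ∩ C` has `f x u ≤ r` is. -/
lemma measurable_sInf_image {F : X → Set Y} {f : X → Y → ℝ} (hc : ∀ x, IsCompact (F x))
    (hne : ∀ x, (F x).Nonempty) (hf : ∀ x, LowerSemicontinuousOn (f x) (F x))
    (hm : ∀ C : Set Y, IsClosed C → ∀ r : ℝ, MeasurableSet {x | ∃ u ∈ F x ∩ C, f x u ≤ r}) :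
    Measurable fun x => sInf (f x '' F x) := by
  refine measurable_of_Iic fun r => ?_
  convert hm univ isClosed_univ r using 1
  ext x
  obtain ⟨u, hu, hmin⟩ := argminSet_nonempty hc hne hf x
  have hl : IsLeast (f x '' F x) (f x u) :=
    ⟨mem_image_of_mem _ hu, by rintro _ ⟨u', hu', rfl⟩; exact hmin u' hu'⟩
  simp only [mem_preimage, mem_Iic, hl.csInf_eq, inter_univ, mem_ofPred_eq]
  exact ⟨fun h => ⟨u, hu, h⟩, fun ⟨u', hu', h⟩ => (hmin u' hu').trans h⟩

/-- The set `argminSet F f x` meets `C` if and only if `F x ∩ C` contains points whose values are at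
most `q`, for every rational `q` above the minimum; by lower semicontinuity and compactness the
minimum is then attained in `C`. -/
lemma closedMeasurable_argminSet {F : X → Set Y} {f : X → Y → ℝ} (hc : ∀ x, IsCompact (F x))
    (hne : ∀ x, (F x).Nonempty) (hf : ∀ x, LowerSemicontinuousOn (f x) (F x))
    (hm : ∀ C : Set Y, IsClosed C → ∀ r : ℝ, MeasurableSet {x | ∃ u ∈ F x ∩ C, f x u ≤ r}) :
    ClosedMeasurable (argminSet F f) := by
  intro C hC
  have hv := measurable_sInf_image hc hne hf hm
  have : {x | (argminSet F f x ∩ C).Nonempty} =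
      ⋂ q : ℚ, ({x | sInf (f x '' F x) < q}ᶜ ∪ {x | ∃ u ∈ F x ∩ C, f x u ≤ q}) := by
    ext x
    obtain ⟨u₀, hu₀, hmin⟩ := argminSet_nonempty hc hne hf x
    have hl : IsLeast (f x '' F x) (f x u₀) :=
      ⟨mem_image_of_mem _ hu₀, by rintro _ ⟨u', hu', rfl⟩; exact hmin u' hu'⟩
    simp only [mem_ofPred_eq, mem_iInter, mem_union, mem_compl_iff, hl.csInf_eq,
      ← imp_iff_not_or]
    constructor
    · rintro ⟨u, ⟨hu, humin⟩, huC⟩ q hq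
      exact ⟨u, ⟨hu, huC⟩, (humin u₀ hu₀).trans hq.le⟩
    · intro h
      obtain ⟨q₀, hq₀⟩ := exists_rat_gt (f x u₀)
      obtain ⟨u₁, hu₁, -⟩ := h q₀ hq₀
      obtain ⟨u, hu, humin⟩ := ((hf x).mono inter_subset_left).exists_isMinOn ⟨u₁, hu₁⟩
        ((hc x).inter_right hC)
      refine ⟨u, ⟨hu.1, fun u' hu' => le_trans ?_ (hmin u' hu')⟩, hu.2⟩
      refine le_of_forall_gt_imp_ge_of_dense fun a ha => ?_
      obtain ⟨q, hq1, hq2⟩ := exists_rat_btwn ha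
      obtain ⟨u₂, hu₂, h2⟩ := h q hq1
      exact (humin hu₂).trans (h2.trans hq2.le)
  rw [this]
  refine MeasurableSet.iInter fun q => ?_
  exact (measurableSet_lt hv measurable_const).compl.union (hm C hC q)

variable [TopologicalSpace.MetrizableSpace Y] [SecondCountableTopology Y] [MeasurableSpace Y]
  [BorelSpace Y]

/-- Measurable selection for compact-valued multifunctions.  The value of the selection is obtained
by lexicographic minimization, over `F x`, of the distances to the points of a dense sequence; these
distances determine a point. -/
theorem ClosedMeasurable.exists_measurable_selection {F : X → Set Y} (hF : ClosedMeasurable F)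
    (hc : ∀ x, IsCompact (F x)) (hne : ∀ x, (F x).Nonempty) :
    ∃ s : X → Y, Measurable s ∧ ∀ x, s x ∈ F x := by
  let _ := TopologicalSpace.metrizableSpaceMetric Y
  rcases isEmpty_or_nonempty X with hX | ⟨⟨x₀⟩⟩
  · exact ⟨fun x => (hX.false x).elim, measurable_of_empty _, fun x => (hX.false x).elim⟩
  have : Nonempty Y := ⟨(hne x₀).some⟩
  let d : ℕ → X → Y → ℝ := fun n _ u => dist u (TopologicalSpace.denseSeq Y n)
  let G : ℕ → X → Set Y := fun n => Nat.rec F (fun n Gn => argminSet Gn (d n)) n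
  have hGs : ∀ n, G (n + 1) = argminSet (G n) (d n) := fun n => rfl
  have hd : ∀ n x, Continuous (d n x) := fun n x => continuous_id.dist continuous_const
  have hG : ∀ n, ClosedMeasurable (G n) ∧ (∀ x, IsCompact (G n x)) ∧ ∀ x, (G n x).Nonempty := by
    intro n
    induction n with
    | zero => exact ⟨hF, hc, hne⟩
    | succ n ih =>
      obtain ⟨h1, h2, h3⟩ := ih
      have hl : ∀ x, LowerSemicontinuousOn (d n x) (G n x) := fun x =>
        (hd n x).lowerSemicontinuous.lowerSemicontinuousOn _
      rw [hGs]
      refine ⟨closedMeasurable_argminSet h2 h3 hl fun C hC r => ?_, isCompact_argminSet h2 hl,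
        argminSet_nonempty h2 h3 hl⟩
      convert h1 (C ∩ {u | dist u (TopologicalSpace.denseSeq Y n) ≤ r})
        (hC.inter (isClosed_le (hd n x₀) continuous_const)) using 3 with x
      simp only [Set.Nonempty, mem_inter_iff, mem_ofPred_eq, d, and_assoc]
  have hanti : ∀ n x, G (n + 1) x ⊆ G n x := fun n x u hu => hu.1
  have hinter : ∀ x (C : Set Y), IsClosed C → (∀ n, (G n x ∩ C).Nonempty) →
      (⋂ n, G n x ∩ C).Nonempty := fun x C hC h =>
    IsCompact.nonempty_iInter_of_sequence_nonempty_isCompact_isClosed _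
      (fun n => inter_subset_inter_left _ (hanti n x)) h (((hG 0).2.1 x).inter_right hC)
      fun n => ((hG n).2.1 x).isClosed.inter hC
  have huniq : ∀ x u u', (∀ n, u ∈ G n x) → (∀ n, u' ∈ G n x) → u = u' := by
    intro x u u' hu hu'
    have h : ∀ n, dist u (TopologicalSpace.denseSeq Y n) =
        dist u' (TopologicalSpace.denseSeq Y n) := fun n =>
      le_antisymm ((hu (n + 1)).2 u' (hu' n)) ((hu' (n + 1)).2 u (hu n))
    have heq : (fun z => dist u z) = fun z => dist u' z :=
      (TopologicalSpace.denseRange_denseSeq Y).equalizer (by fun_prop) (by fun_prop)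
        (funext h)
    have := congrFun heq u
    rw [dist_self] at this
    exact (dist_eq_zero.1 this.symm).symm
  have hex : ∀ x, ∃ u, ∀ n, u ∈ G n x := fun x => by
    obtain ⟨u, hu⟩ := hinter x univ isClosed_univ fun n => by
      rw [inter_univ]
      exact (hG n).2.2 x
    exact ⟨u, fun n => (mem_iInter.1 hu n).1⟩
  choose s hs using hex
  refine ⟨s, measurable_of_isClosed fun C hC => ?_, fun x => hs x 0⟩
  have : s ⁻¹' C = ⋂ n, {x | (G n x ∩ C).Nonempty} := by
    ext x
    simp only [mem_preimage, mem_iInter, mem_ofPred_eq]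
    refine ⟨fun h n => ⟨s x, hs x n, h⟩, fun h => ?_⟩
    obtain ⟨u, hu⟩ := hinter x C hC h
    rw [huniq x (s x) u (hs x) fun n => (mem_iInter.1 hu n).1]
    exact (mem_iInter.1 hu 0).2
  rw [this]
  exact MeasurableSet.iInter fun n => (hG n).1 C hC

variable [TopologicalSpace X] [TopologicalSpace.MetrizableSpace X] [OpensMeasurableSpace X]

omit [TopologicalSpace.MetrizableSpace Y] [MeasurableSpace Y] [BorelSpace Y]
  [TopologicalSpace.MetrizableSpace X] in
lemma MeasurableMultifunction.measurableSet_open {U : X → Set Y} (hU : MeasurableMultifunction U)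
    {G : Set (X × Y)} (hG : IsOpen G) : MeasurableSet {x | ∃ u ∈ U x, (x, u) ∈ G} := by
  let A : Set Y → Set X := fun O => ⋃₀ {A | IsOpen A ∧ A ×ˢ O ⊆ G}
  have : {x | ∃ u ∈ U x, (x, u) ∈ G} =
      ⋃ O ∈ TopologicalSpace.countableBasis Y, A O ∩ {x | (U x ∩ O).Nonempty} := by
    ext x
    simp only [mem_ofPred_eq, mem_iUnion, mem_inter_iff, exists_prop]
    constructor
    · rintro ⟨u, hu, hxu⟩
      obtain ⟨V, W, hV, hW, hxV, huW, hVW⟩ := isOpen_prod_iff.1 hG x u hxu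
      obtain ⟨O, hO, huO, hOW⟩ :=
        (TopologicalSpace.isBasis_countableBasis Y).exists_subset_of_mem_open huW hW
      exact ⟨O, hO, ⟨V, ⟨hV, (prod_mono_right hOW).trans hVW⟩, hxV⟩, u, hu, huO⟩
    · rintro ⟨O, hO, ⟨V, ⟨hV, hVG⟩, hxV⟩, u, hu, huO⟩
      exact ⟨u, hu, hVG ⟨hxV, huO⟩⟩
  rw [this]
  refine MeasurableSet.biUnion (TopologicalSpace.countable_countableBasis Y) fun O hO => ?_
  exact (isOpen_sUnion fun A hA => hA.1).measurableSet.inter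
    (hU O ((TopologicalSpace.isBasis_countableBasis Y).isOpen hO))

omit [MeasurableSpace Y] [BorelSpace Y] in
/-- A closed set is the intersection of its open neighbourhoods of radius `1 / (n + 1)`; compactness
of `U x` turns points of `U x` close to the section of `K` into a point of the section. -/
lemma MeasurableMultifunction.measurableSet_closed {U : X → Set Y}
    (hU : MeasurableMultifunction U) (hc : ∀ x, IsCompact (U x)) {K : Set (X × Y)}
    (hK : IsClosed K) : MeasurableSet {x | ∃ u ∈ U x, (x, u) ∈ K} := by
  let _ := TopologicalSpace.metrizableSpaceMetric X
  let _ := TopologicalSpace.metrizableSpaceMetric Y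
  have : {x | ∃ u ∈ U x, (x, u) ∈ K} =
      ⋂ n : ℕ, {x | ∃ u ∈ U x, (x, u) ∈ Metric.thickening (1 / ((n : ℝ) + 1)) K} := by
    ext x
    simp only [mem_ofPred_eq, mem_iInter]
    constructor
    · rintro ⟨u, hu, h⟩ n
      exact ⟨u, hu, Metric.self_subset_thickening (by positivity) K h⟩
    · intro h
      choose u hu hK' using h
      obtain ⟨u₀, hu₀, φ, hφ, hlim⟩ := (hc x).tendsto_subseq hu
      refine ⟨u₀, hu₀, ?_⟩
      choose z hzK hz using fun n => Metric.mem_thickening_iff.1 (hK' n)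
      refine hK.mem_of_tendsto (b := atTop) (f := fun n => z (φ n)) ?_
        (Eventually.of_forall fun n => hzK _)
      have h1 : Tendsto (fun n => (x, u (φ n))) atTop (𝓝 (x, u₀)) :=
        tendsto_const_nhds.prodMk_nhds hlim
      refine h1.congr_dist ?_
      refine squeeze_zero (fun _ => dist_nonneg) (fun n => (hz (φ n)).le) ?_
      exact tendsto_one_div_add_atTop_nhds_zero_nat.comp hφ.tendsto_atTop
  rw [this]
  exact MeasurableSet.iInter fun n => hU.measurableSet_open Metric.isOpen_thickening

/-- Measurable minimization over a measurable compact-valued multifunction `U`.  The function `f` is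
only supposed to be lower semicontinuous on the parts `{w ≤ N}` of the graph of `U`: these pieces
are covered one at a time, and on each of them a sublevel set of `f` is the trace of a closed
set. -/
theorem MeasurableMultifunction.exists_measurable_argmin {U : X → Set Y}
    (hU : MeasurableMultifunction U) (hc : ∀ x, IsCompact (U x)) (hne : ∀ x, (U x).Nonempty)
    {w : X → ℝ} (hw : Measurable w) {f : X → Y → ℝ}
    (hf : ∀ (N r : ℝ) (xs : ℕ → X) (us : ℕ → Y) (x : X) (u : Y), (∀ k, us k ∈ U (xs k)) →
      (∀ k, w (xs k) ≤ N) → (∀ k, f (xs k) (us k) ≤ r) → Tendsto xs atTop (𝓝 x) →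
      Tendsto us atTop (𝓝 u) → u ∈ U x → w x ≤ N → f x u ≤ r) :
    ∃ s : X → Y, Measurable s ∧ (∀ x, s x ∈ U x) ∧ (∀ x, ∀ u ∈ U x, f x (s x) ≤ f x u) ∧
      Measurable fun x => f x (s x) := by
  let _ := TopologicalSpace.metrizableSpaceMetric X
  let _ := TopologicalSpace.metrizableSpaceMetric Y
  have hlsc : ∀ x, LowerSemicontinuousOn (f x) (U x) := by
    intro x
    rw [lowerSemicontinuousOn_iff_preimage_Iic]
    intro r
    refine ⟨U x ∩ f x ⁻¹' Iic r, ?_, by rw [← inter_assoc, inter_self]⟩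
    refine IsSeqClosed.isClosed fun us u hus hlim => ?_
    have hu : u ∈ U x := (hc x).isClosed.mem_of_tendsto hlim
      (Eventually.of_forall fun k => (hus k).1)
    exact ⟨hu, hf (w x) r (fun _ => x) us x u (fun k => (hus k).1) (fun _ => le_rfl)
      (fun k => (hus k).2) tendsto_const_nhds hlim hu le_rfl⟩
  have hm : ∀ C : Set Y, IsClosed C → ∀ r : ℝ, MeasurableSet {x | ∃ u ∈ U x ∩ C, f x u ≤ r} := by
    intro C hC r
    let K : ℕ → Set (X × Y) := fun N =>
      closure {z | z.2 ∈ U z.1 ∩ C ∧ w z.1 ≤ N ∧ f z.1 z.2 ≤ r}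
    have : {x | ∃ u ∈ U x ∩ C, f x u ≤ r} =
        ⋃ N : ℕ, ({x | w x ≤ N} ∩ {x | ∃ u ∈ U x, (x, u) ∈ K N}) := by
      ext x
      simp only [mem_ofPred_eq, mem_iUnion, mem_inter_iff]
      constructor
      · rintro ⟨u, hu, h⟩
        obtain ⟨N, hN⟩ := exists_nat_ge (w x)
        exact ⟨N, hN, u, hu.1, subset_closure ⟨hu, hN, h⟩⟩
      · rintro ⟨N, hN, u, hu, h⟩
        obtain ⟨z, hz, hlim⟩ := mem_closure_iff_seq_limit.1 h
        have h1 : Tendsto (fun k => (z k).1) atTop (𝓝 x) :=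
          (continuous_fst.tendsto _).comp hlim
        have h2 : Tendsto (fun k => (z k).2) atTop (𝓝 u) :=
          (continuous_snd.tendsto _).comp hlim
        refine ⟨u, ⟨hu, hC.mem_of_tendsto h2 (Eventually.of_forall fun k => (hz k).1.2)⟩, ?_⟩
        exact hf N r _ _ x u (fun k => (hz k).1.1) (fun k => (hz k).2.1) (fun k => (hz k).2.2)
          h1 h2 hu hN
    rw [this]
    exact MeasurableSet.iUnion fun N => (measurableSet_le hw measurable_const).inter
      (hU.measurableSet_closed hc isClosed_closure)
  obtain ⟨s, hs, hsm⟩ := (closedMeasurable_argminSet hc hne hlsc hm).exists_measurable_selection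
    (isCompact_argminSet hc hlsc) (argminSet_nonempty hc hne hlsc)
  refine ⟨s, hs, fun x => (hsm x).1, fun x => (hsm x).2, ?_⟩
  convert measurable_sInf_image hc hne hlsc hm using 2 with x
  refine (IsLeast.csInf_eq ⟨mem_image_of_mem _ (hsm x).1, ?_⟩).symm
  rintro _ ⟨u, hu, rfl⟩
  exact (hsm x).2 u hu

end Selection

/-! ### Lower semicontinuity of the minimized function -/

section Costs

variable {X 𝒰 : Type*} [MeasurableSpace X] [MeasurableSpace 𝒰] {p : ℝ≥0∞} {P₀ : Measure X}

lemma toV_eq {φ : X → ℝ} (hφ : MemLp φ p P₀) : toV p P₀ φ = hφ.toLp φ := dif_pos hφ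

lemma toV_mono {φ ψ : X → ℝ} (hφ : MemLp φ p P₀) (hψ : MemLp ψ p P₀) (h : ∀ y, φ y ≤ ψ y) :
    toV p P₀ φ ≤ toV p P₀ ψ := by
  rw [toV_eq hφ, toV_eq hψ, ← Lp.coeFn_le]
  filter_upwards [hφ.coeFn_toLp, hψ.coeFn_toLp] with y h1 h2
  rw [h1, h2]
  exact h y

lemma DualProb.integral_toV (m : DualProb p P₀) {φ : X → ℝ} (hφ : MemLp φ p P₀) :
    ∫ y, toV p P₀ φ y ∂m.1 = ∫ y, φ y ∂m.1 := by
  rw [toV_eq hφ]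
  exact integral_congr_ae (m.2.2.1.ae_le hφ.coeFn_toLp)

lemma isOpen_lt_integral (r : ℝ) (φ : Lp ℝ p P₀) :
    IsOpen {m : DualProb p P₀ | r < ∫ y, φ y ∂m.1} := by
  have h : Continuous fun (m : DualProb p P₀) (φ : Lp ℝ p P₀) => ∫ y, φ y ∂m.1 :=
    continuous_induced_dom
  exact isOpen_lt continuous_const ((continuous_apply φ).comp h)

lemma exists_measure_subdiff_eq [Fact (1 ≤ p)] [IsProbabilityMeasure P₀] (hp : p ≠ ∞)
    {σ : Lp ℝ p P₀ → X → DualProb p P₀ → ℝ} (hσ : IsRiskTransitionMapping σ) (φ : Lp ℝ p P₀)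
    (x : X) (m : DualProb p P₀) : ∃ μ ∈ subdiff σ x m, ∫ y, φ y ∂μ.1 = σ φ x m := by
  obtain ⟨μ, hμ, h⟩ := (hσ.coherent x m).exists_integral_eq hp φ
  refine ⟨μ, fun ψ => ?_, h⟩
  rw [show σ 0 x m = 0 from (hσ.coherent x m).map_zero, zero_add]
  exact hμ ψ

lemma integral_le_of_mem_subdiff [Fact (1 ≤ p)] [IsProbabilityMeasure P₀]
    {σ : Lp ℝ p P₀ → X → DualProb p P₀ → ℝ} (hσ : IsRiskTransitionMapping σ)
    {x : X} {m μ : DualProb p P₀} (hμ : μ ∈ subdiff σ x m) (φ : Lp ℝ p P₀) :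
    ∫ y, φ y ∂μ.1 ≤ σ φ x m := by
  have h := hμ φ
  rwa [show σ 0 x m = 0 from (hσ.coherent x m).map_zero, zero_add] at h

namespace Model

variable {D : Model X 𝒰} [TopologicalSpace X] [TopologicalSpace 𝒰] {w : X → ℝ}

lemma G3.measurable_section (h3 : D.G3 w) (x : X) (u : 𝒰) : Measurable fun y => D.c x u y :=
  h3.measurable.comp (by fun_prop : Measurable fun y : X => (x, u, y))

lemma G3.memLp_cost [IsFiniteMeasure P₀] (h3 : D.G3 w) (hw : IsWeight p P₀ w) (z : D.Graph) :
    MemLp (fun y => D.c z.1.1 z.1.2 y) p P₀ := by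
  obtain ⟨C, -, hC⟩ := h3.bounded
  refine (((memLp_const (w z.1.1)).add hw.memLp).const_mul C).mono
    (h3.measurable_section _ _).aestronglyMeasurable (ae_of_all _ fun y => ?_)
  rw [Real.norm_eq_abs]
  exact (hC _ _ z.2 y).trans (le_abs_self _)

lemma tendsto_kernelM (h0 : D.G0 p P₀) (h1 : D.G1 p P₀) {zs : ℕ → D.Graph} {z : D.Graph}
    (h : Tendsto zs atTop (𝓝 z)) :
    Tendsto (fun k => kernelM h0 (zs k)) atTop (𝓝 (kernelM h0 z)) := by
  rw [nhds_induced, tendsto_comap_iff, tendsto_pi_nhds]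
  exact fun φ => ((h1 φ).tendsto z).comp h

/-- Lower semicontinuity, along sequences in a part `{w ≤ N}` of the graph of `U`, of the function
minimized in the dynamic programming equations.  Let `μ` be a subgradient with
`∫ (c(z, ·) + v) dμ = σ(c(z, ·) + v)`.  The minorants `min (inf_{k ≥ K} c(z_k, ·)) (c(z, ·)) + v`
converge to `c(z, ·) + v` as `K → ∞`, and `G2` makes subgradients at `z_k` integrate such a
minorant to nearly the value that `μ` gives it.  The bound `w ≤ N` provides the domination. -/
theorem dpValue_le_of_tendsto [Fact (1 ≤ p)] [IsProbabilityMeasure P₀] (hp : p ≠ ∞)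
    (hw : IsWeight p P₀ w) {σ : Lp ℝ p P₀ → X → DualProb p P₀ → ℝ}
    (hσ : IsRiskTransitionMapping σ) (h0 : D.G0 p P₀) (h1 : D.G1 p P₀) (h2 : G2 σ) (h3 : D.G3 w)
    {v : X → ℝ} (hv : MemLp v p P₀) {N r : ℝ} {zs : ℕ → D.Graph} {z : D.Graph}
    (hz : Tendsto zs atTop (𝓝 z)) (hzsN : ∀ k, w (zs k).1.1 ≤ N) (hzN : w z.1.1 ≤ N)
    (hr : ∀ k, dpValue h0 σ v (zs k) ≤ r) : dpValue h0 σ v z ≤ r := by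
  by_contra! hlt
  obtain ⟨C, hC0, hC⟩ := h3.bounded
  have hCN : ∀ z' : D.Graph, w z'.1.1 ≤ N → ∀ y, |D.c z'.1.1 z'.1.2 y| ≤ C * (N + w y) :=
    fun z' hz' y => (hC _ _ z'.2 y).trans (by gcongr)
  have hmem : ∀ z' : D.Graph, MemLp (fun y => D.c z'.1.1 z'.1.2 y + v y) p P₀ := fun z' =>
    (h3.memLp_cost hw z').add hv
  -- an infimum over a set bounded below, hence not a junk value
  let b : ℕ → X → ℝ := fun K y => ⨅ k, D.c (zs (K + k)).1.1 (zs (K + k)).1.2 y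
  have hbdd : ∀ K y, BddBelow (range fun k => D.c (zs (K + k)).1.1 (zs (K + k)).1.2 y) :=
    fun K y => ⟨-(C * (N + w y)), by
      rintro _ ⟨k, rfl⟩
      exact (abs_le.1 (hCN _ (hzsN _) y)).1⟩
  have hbm : ∀ K, Measurable (b K) := fun K => Measurable.iInf fun k => h3.measurable_section _ _
  let θ : ℕ → X → ℝ := fun K y => min (b K y) (D.c z.1.1 z.1.2 y) + v y
  have hmin : ∀ K y, |min (b K y) (D.c z.1.1 z.1.2 y)| ≤ C * (N + w y) := fun K y => by
    have hz1 := abs_le.1 (hCN z hzN y)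
    exact abs_le.2 ⟨le_min (le_ciInf fun k => (abs_le.1 (hCN _ (hzsN _) y)).1) hz1.1,
      (min_le_right _ _).trans hz1.2⟩
  have hdom : MemLp (fun y => C * (N + w y)) p P₀ :=
    ((memLp_const N).add hw.memLp).const_mul C
  have hθ : ∀ K, MemLp (θ K) p P₀ := fun K => by
    refine MemLp.add (hdom.mono
      ((hbm K).min (h3.measurable_section _ _)).aestronglyMeasurable (ae_of_all _ fun y => ?_)) hv
    rw [Real.norm_eq_abs]
    exact (hmin K y).trans (le_abs_self _)
  have hθz : ∀ y, Tendsto (fun K => θ K y) atTop (𝓝 (D.c z.1.1 z.1.2 y + v y)) := fun y => by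
    refine Tendsto.add_const _ ?_
    refine tendsto_order.2 ⟨fun a ha => ?_, fun a ha =>
      Eventually.of_forall fun K => (min_le_right _ _).trans_lt ha⟩
    obtain ⟨a', haa', ha'⟩ := exists_between ha
    obtain ⟨K₀, hK₀⟩ := eventually_atTop.1 (hz.eventually (h3.lsc y z a' ha'))
    refine eventually_atTop.2 ⟨K₀, fun K hK => lt_min (haa'.trans_le ?_) ha⟩
    exact le_ciInf fun k => (hK₀ (K + k) (by omega)).le
  obtain ⟨μ, hμ, hμz⟩ := exists_measure_subdiff_eq hp hσ
    (toV p P₀ fun y => D.c z.1.1 z.1.2 y + v y) z.1.1 (kernelM h0 z)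
  rw [μ.integral_toV (hmem z)] at hμz
  have hlim : Tendsto (fun K => ∫ y, θ K y ∂μ.1) atTop
      (𝓝 (∫ y, (D.c z.1.1 z.1.2 y + v y) ∂μ.1)) := by
    refine tendsto_integral_of_dominated_convergence (fun y => C * (N + w y) + ‖v y‖)
      (fun K => (μ.integrable (hθ K)).aestronglyMeasurable)
      (μ.integrable (hdom.add hv.norm)) (fun K => ae_of_all _ fun y => ?_) (ae_of_all _ hθz)
    refine (norm_add_le _ _).trans ?_
    gcongr
    exact hmin K y
  have hrμ : r < ∫ y, (D.c z.1.1 z.1.2 y + v y) ∂μ.1 := by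
    rw [hμz]
    exact hlt
  obtain ⟨K, hK⟩ := (hlim.eventually_const_lt hrμ).exists
  have hpair : Tendsto (fun k => ((zs k).1.1, kernelM h0 (zs k))) atTop
      (𝓝 (z.1.1, kernelM h0 z)) :=
    (((continuous_fst.comp continuous_subtype_val).tendsto z).comp hz).prodMk_nhds
      (tendsto_kernelM h0 h1 hz)
  have hev := h2 _ _ hpair _ (isOpen_lt_integral r (toV p P₀ (θ K)))
    ⟨μ, hμ, by rw [mem_ofPred_eq, μ.integral_toV (hθ K)]; exact hK⟩
  obtain ⟨k, ⟨m, hm, hmr⟩, hkK⟩ := (hev.and (eventually_ge_atTop K)).exists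
  have hle : ∫ y, toV p P₀ (θ K) y ∂m.1 ≤ dpValue h0 σ v (zs k) := by
    refine le_trans ?_ (integral_le_of_mem_subdiff hσ hm _)
    rw [m.integral_toV (hθ K), m.integral_toV (hmem (zs k))]
    refine integral_mono (m.integrable (hθ K)) (m.integrable (hmem (zs k))) fun y => ?_
    refine add_le_add ((min_le_left _ _).trans ?_) le_rfl
    refine (ciInf_le (hbdd K y) (k - K)).trans (le_of_eq ?_)
    rw [Nat.add_sub_cancel' hkK]
  exact absurd (hr k) (not_le.2 (hmr.trans_le hle))

end Model

end Costs

/-! ### Dynamic programming -/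

section DynamicProgramming

variable {X 𝒰 : Type*} [MeasurableSpace X] [MeasurableSpace 𝒰] {p : ℝ≥0∞} {P₀ : Measure X}

namespace Model

variable {D : Model X 𝒰}

/-- The function `dpValue`, extended by `0` to all pairs `(x, u)`. -/
def dpValueExt (h0 : D.G0 p P₀) (σ : Lp ℝ p P₀ → X → DualProb p P₀ → ℝ) (v : X → ℝ)
    (x : X) (u : 𝒰) : ℝ :=
  open Classical in if hu : u ∈ D.U x then dpValue h0 σ v ⟨(x, u), hu⟩ else 0

lemma dpValueExt_eq (h0 : D.G0 p P₀) (σ : Lp ℝ p P₀ → X → DualProb p P₀ → ℝ) (v : X → ℝ)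
    {x : X} {u : 𝒰} (hu : u ∈ D.U x) : dpValueExt h0 σ v x u = dpValue h0 σ v ⟨(x, u), hu⟩ :=
  dif_pos hu

/-- One step of dynamic programming: the minimum is attained by a measurable decision rule, and it
is a measurable function of the state. -/
lemma exists_measurable_rule
    [TopologicalSpace X] [TopologicalSpace.MetrizableSpace X] [OpensMeasurableSpace X]
    [TopologicalSpace 𝒰] [TopologicalSpace.MetrizableSpace 𝒰] [SecondCountableTopology 𝒰]
    [BorelSpace 𝒰] [Fact (1 ≤ p)] [IsProbabilityMeasure P₀] (hp : p ≠ ∞) {w : X → ℝ}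
    (hw : IsWeight p P₀ w) {σ : Lp ℝ p P₀ → X → DualProb p P₀ → ℝ}
    (hσ : IsRiskTransitionMapping σ) (h0 : D.G0 p P₀) (h1 : D.G1 p P₀) (h2 : G2 σ) (h3 : D.G3 w)
    (h4 : D.G4) {v : X → ℝ} (hv : MemLp v p P₀) :
    ∃ s : X → 𝒰, Measurable s ∧ (∀ x, s x ∈ D.U x) ∧
      (∀ x, ∀ u ∈ D.U x, dpValueExt h0 σ v x (s x) ≤ dpValueExt h0 σ v x u) ∧
      Measurable fun x => dpValueExt h0 σ v x (s x) := by
  refine h4.measurable.exists_measurable_argmin h4.compact D.U_nonempty hw.measurable ?_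
  intro N r xs us x u hus hxsN hr hx hu hux hxN
  have hz : Tendsto (fun k => (⟨(xs k, us k), hus k⟩ : D.Graph)) atTop (𝓝 ⟨(x, u), hux⟩) :=
    tendsto_subtype_rng.2 (hx.prodMk_nhds hu)
  rw [dpValueExt_eq h0 σ v hux]
  refine dpValue_le_of_tendsto hp hw hσ h0 h1 h2 h3 hv hz hxsN hxN fun k => ?_
  rw [← dpValueExt_eq]
  exact hr k

lemma lastCost_append {n : ℕ} (h : D.Hist n) (u : 𝒰) (hu : u ∈ D.U h.2) (y : X) :
    lastCost (h.append u hu y) = D.c h.2 u y := by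
  simp [lastCost, Hist.append]

/-- The nested risk of a Markov policy is computed by the backward recursion
`vₙ(x) = σ(c(x, πₙ(x), ·) + vₙ₊₁, x, Q(x, πₙ(x)))`. -/
lemma nestedRisk_markov_eq (h0 : D.G0 p P₀) (σ : Lp ℝ p P₀ → X → DualProb p P₀ → ℝ) {g : X → ℝ}
    {T n₀ : ℕ} {v : ℕ → X → ℝ} (π : D.MarkovPolicy) (hT : v T = g)
    (hv : ∀ n, n₀ ≤ n → n < T → ∀ x, v n x = dpValueExt h0 σ (v (n + 1)) x (π.rule n x)) :
    ∀ k n, n₀ ≤ n → n + k = T → ∀ h : D.Hist n,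
      nestedRisk h0 σ g π.toPolicy k n h = v n h.2 := by
  intro k
  induction k with
  | zero =>
    rintro n - rfl h
    rw [← hT]
    rfl
  | succ k ih =>
    intro n hn hnk h
    rw [hv n hn (by omega) h.2, dpValueExt_eq h0 σ _ (π.feasible n h.2)]
    have : sect π.toPolicy n
        (fun h' => lastCost h' + nestedRisk h0 σ g π.toPolicy k (n + 1) h') h =
        fun y => D.c h.2 (π.rule n h.2) y + v (n + 1) y := by
      funext y
      rw [sect, lastCost_append, ih (n + 1) (by omega) (by omega)]
      rfl
    rw [nestedRisk, condRisk, this]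
    rfl

/-- A function solving the dynamic programming equations bounds from below the nested risk of every
policy: this follows backwards in time from the monotonicity of `σ`. -/
lemma le_nestedRisk [Fact (1 ≤ p)] [IsProbabilityMeasure P₀]
    [TopologicalSpace X] [TopologicalSpace 𝒰] {w : X → ℝ}
    (hw : IsWeight p P₀ w) {σ : Lp ℝ p P₀ → X → DualProb p P₀ → ℝ}
    (hσ : IsRiskTransitionMapping σ) (h0 : D.G0 p P₀) (h3 : D.G3 w) {g : X → ℝ} {T : ℕ}
    {v : ℕ → X → ℝ} (hv : SolvesDP h0 σ g T v)
    (hvp : ∀ n, 1 ≤ n → n ≤ T → MemLp (v n) p P₀) {π : D.Policy} (hπ : WellDefined h0 σ g T π) :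
    ∀ k n, n + k = T → ∀ h : D.Hist n, v n h.2 ≤ nestedRisk h0 σ g π k n h := by
  intro k
  induction k with
  | zero =>
    rintro n rfl h
    rw [← hv.1]
    exact le_rfl
  | succ k ih =>
    intro n hnk h
    refine ((hv.2 n (by omega) h.2).2 ⟨_, π.feasible n h, rfl⟩).trans ?_
    refine (hσ.coherent _ _).mono _ _ (toV_mono ?_ (hπ k n (by omega) h) fun y => ?_)
    · exact (h3.memLp_cost hw ⟨(h.2, π.rule n h), π.feasible n h⟩).add
        (hvp (n + 1) (by omega) (by omega))
    · rw [sect, lastCost_append]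
      exact add_le_add le_rfl (ih (n + 1) (by omega)
        (h.append (π.rule n h) (π.feasible n h) y))

lemma SolvesDP.eq_of_le {h0 : D.G0 p P₀} {σ : Lp ℝ p P₀ → X → DualProb p P₀ → ℝ} {g : X → ℝ}
    {T : ℕ} {v v' : ℕ → X → ℝ} (hv : SolvesDP h0 σ g T v) (hv' : SolvesDP h0 σ g T v') {n : ℕ}
    (hn : n ≤ T) : v n = v' n := by
  induction hn using Nat.decreasingInduction with
  | self => rw [hv.1, hv'.1]
  | of_succ n hn ih =>
    funext x
    refine (hv.2 n hn x).unique ?_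
    rw [ih]
    exact hv'.2 n hn x

/-- Backward construction of a solution of the dynamic programming equations and of a Markov policy
attaining the minima.  That `vₙ` lies in `L_p` for `n ≥ 1` is read off from the well-definedness of
the objective for the policy constructed so far, at the stage `n - 1`. -/
lemma exists_solution
    [TopologicalSpace X] [TopologicalSpace.MetrizableSpace X] [OpensMeasurableSpace X]
    [TopologicalSpace 𝒰] [TopologicalSpace.MetrizableSpace 𝒰] [SecondCountableTopology 𝒰]
    [BorelSpace 𝒰] [Fact (1 ≤ p)] [IsProbabilityMeasure P₀] (hp : p ≠ ∞) {w : X → ℝ}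
    (hw : IsWeight p P₀ w) {σ : Lp ℝ p P₀ → X → DualProb p P₀ → ℝ}
    (hσ : IsRiskTransitionMapping σ) (h0 : D.G0 p P₀) (h1 : D.G1 p P₀) (h2 : G2 σ) (h3 : D.G3 w)
    (h4 : D.G4) {T : ℕ} {g : X → ℝ} (hg : Measurable g) (hgp : MemLp g p P₀)
    (hJ : ∀ π : D.MarkovPolicy, WellDefined h0 σ g T π.toPolicy) :
    ∃ (v : ℕ → X → ℝ) (π : D.MarkovPolicy), SolvesDP h0 σ g T v ∧ IsArgmin h0 σ T v π ∧
      (∀ n ≤ T, Measurable (v n)) ∧ ∀ n, 1 ≤ n → n ≤ T → MemLp (v n) p P₀ := by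
  suffices key : ∀ n₀ ≤ T, ∃ (v : ℕ → X → ℝ) (π : D.MarkovPolicy), v T = g ∧
      (∀ n, n₀ ≤ n → n < T → ∀ x, v n x = dpValueExt h0 σ (v (n + 1)) x (π.rule n x) ∧
        ∀ u ∈ D.U x, v n x ≤ dpValueExt h0 σ (v (n + 1)) x u) ∧
      (∀ n, n₀ ≤ n → n ≤ T → Measurable (v n)) ∧
      ∀ n, n₀ ≤ n → 1 ≤ n → n ≤ T → MemLp (v n) p P₀ by
    obtain ⟨v, π, hT, hv, hm, hvp⟩ := key 0 (Nat.zero_le T)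
    refine ⟨v, π, ⟨hT, fun n hn x => ⟨⟨π.rule n x, π.feasible n x, ?_⟩, ?_⟩⟩, ?_,
      fun n => hm n (Nat.zero_le n), fun n => hvp n (Nat.zero_le n)⟩
    · rw [← dpValueExt_eq]
      exact (hv n (Nat.zero_le n) hn x).1
    · rintro _ ⟨u, hu, rfl⟩
      rw [← dpValueExt_eq]
      exact (hv n (Nat.zero_le n) hn x).2 u hu
    · intro n hn x u hu
      rw [← dpValueExt_eq, ← dpValueExt_eq, ← (hv n (Nat.zero_le n) hn x).1]
      exact (hv n (Nat.zero_le n) hn x).2 u hu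
  intro n₀ hn₀
  induction hn₀ using Nat.decreasingInduction with
  | self =>
    obtain ⟨s, hs, hsU, -, -⟩ := exists_measurable_rule hp hw hσ h0 h1 h2 h3 h4 hgp
    refine ⟨fun _ => g, ⟨fun _ => s, fun _ => hs, fun _ => hsU⟩, rfl, fun n h h' => ?_,
      fun _ _ _ => hg, fun _ _ _ _ => hgp⟩
    omega
  | of_succ n₀ hn₀ ih =>
    obtain ⟨v, π, hT, hv, hm, hvp⟩ := ih
    obtain ⟨s, hs, hsU, hmin, hsm⟩ := exists_measurable_rule hp hw hσ h0 h1 h2 h3 h4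
      (hvp (n₀ + 1) le_rfl (by omega) hn₀)
    let v' : ℕ → X → ℝ := Function.update v n₀ fun x => dpValueExt h0 σ (v (n₀ + 1)) x (s x)
    let π' : D.MarkovPolicy :=
      { rule := Function.update π.rule n₀ s
        measurable := fun n => by
          rcases eq_or_ne n n₀ with rfl | hn
          · simpa using hs
          · simpa [hn] using π.measurable n
        feasible := fun n x => by
          rcases eq_or_ne n n₀ with rfl | hn
          · simpa using hsU x
          · simpa [hn] using π.feasible n x }
    have hv'₀ : v' n₀ = fun x => dpValueExt h0 σ (v (n₀ + 1)) x (s x) := Function.update_self ..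
    have hv'₁ : ∀ n, n₀ + 1 ≤ n → v' n = v n := fun n hn =>
      Function.update_of_ne (by omega) _ _
    have hπ'₀ : π'.rule n₀ = s := Function.update_self ..
    have hπ'₁ : ∀ n, n₀ + 1 ≤ n → π'.rule n = π.rule n := fun n hn =>
      Function.update_of_ne (by omega) _ _
    have hT' : v' T = g := by rw [hv'₁ T hn₀, hT]
    have hv' : ∀ n, n₀ ≤ n → n < T → ∀ x,
        v' n x = dpValueExt h0 σ (v' (n + 1)) x (π'.rule n x) ∧
        ∀ u ∈ D.U x, v' n x ≤ dpValueExt h0 σ (v' (n + 1)) x u := by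
      intro n hn hnT x
      rw [hv'₁ (n + 1) (by omega)]
      rcases hn.eq_or_lt with rfl | hlt
      · rw [hv'₀, hπ'₀]
        exact ⟨rfl, hmin x⟩
      · rw [hv'₁ n hlt, hπ'₁ n hlt]
        exact hv n hlt hnT x
    refine ⟨v', π', hT', hv', fun n hn hnT => ?_, fun n hn hn1 hnT => ?_⟩
    · rcases hn.eq_or_lt with rfl | hlt
      · rw [hv'₀]
        exact hsm
      · rw [hv'₁ n hlt]
        exact hm n hlt hnT
    · rcases hn.eq_or_lt with rfl | hlt
      · obtain ⟨n, rfl⟩ : ∃ n, n₀ = n + 1 := ⟨n₀ - 1, by omega⟩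
        obtain ⟨x⟩ : Nonempty X := P₀.nonempty_of_neZero
        -- any history will do, since the policy is Markov
        let h : D.Hist n := (fun _ => ⟨(x, π'.rule 0 x), π'.feasible 0 x⟩, x)
        have h5 := hJ π' (T - (n + 1)) n (by omega) h
        have h6 : sect π'.toPolicy n (fun h' => lastCost h' +
            nestedRisk h0 σ g π'.toPolicy (T - (n + 1)) (n + 1) h') h =
            fun y => D.c x (π'.rule n x) y + v' (n + 1) y := by
          funext y
          rw [sect, lastCost_append, nestedRisk_markov_eq h0 σ π' hT'
            (fun n hn hnT x => (hv' n hn hnT x).1) _ _ le_rfl (by omega)]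
          rfl
        rw [h6] at h5
        convert h5.sub (h3.memLp_cost hw ⟨(x, π'.rule n x), π'.feasible n x⟩) using 1
        funext y
        simp
      · rw [hv'₁ n hlt]
        exact hvp n hlt hn1 hnT

end Model

end DynamicProgramming

end

end RiskMDP

theorem theoremt {X 𝒰 : Type*}
    [TopologicalSpace X] [TopologicalSpace.MetrizableSpace X] [SecondCountableTopology X]
    [MeasurableSpace X] [BorelSpace X] [StandardBorelSpace X]
    [TopologicalSpace 𝒰] [TopologicalSpace.MetrizableSpace 𝒰] [SecondCountableTopology 𝒰]
    [MeasurableSpace 𝒰] [BorelSpace 𝒰] [StandardBorelSpace 𝒰]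
    (D : RiskMDP.Model X 𝒰)
    (p : ℝ≥0∞) [Fact (1 ≤ p)] (hp : p ≠ ∞)
    (P₀ : Measure X) [IsProbabilityMeasure P₀]
    (w : X → ℝ) (hw : RiskMDP.IsWeight p P₀ w)
    (σ : Lp ℝ p P₀ → X → RiskMDP.DualProb p P₀ → ℝ) (hσ : RiskMDP.IsRiskTransitionMapping σ)
    (h0 : D.G0 p P₀) (h1 : D.G1 p P₀) (h2 : RiskMDP.G2 σ) (h3 : D.G3 w) (h4 : D.G4)
    (T : ℕ)
    (g : X → ℝ) (hg : Measurable g) (hgw : ∃ C : ℝ, ∀ x, |g x| ≤ C * w x)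
    -- the objective of the problem is well defined for all Markov policies
    (hJ : ∀ π : D.MarkovPolicy, RiskMDP.Model.WellDefined h0 σ g T π.toPolicy) :
    -- the dynamic programming equations have a (measurable) solution
    (∃ v : ℕ → X → ℝ, RiskMDP.Model.SolvesDP h0 σ g T v ∧
      (∀ n ≤ T, Measurable (v n)) ∧ (∀ n, 1 ≤ n → n ≤ T → MemLp (v n) p P₀)) ∧
    ∀ v : ℕ → X → ℝ, RiskMDP.Model.SolvesDP h0 σ g T v →
      -- the problem has a solution, and its optimal value is the first of these functions
      (∀ x, IsLeast {r : ℝ | ∃ π : D.Policy, RiskMDP.Model.WellDefined h0 σ g T π ∧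
        r = RiskMDP.Model.J h0 σ g T π x} (v 0 x)) ∧
      -- some Markov policy satisfies the argmin equations and is optimal
      (∃ π : D.MarkovPolicy, RiskMDP.Model.IsArgmin h0 σ T v π ∧
        RiskMDP.Model.IsOptimal h0 σ g T π.toPolicy) ∧
      -- every Markov policy that satisfies the argmin equations is optimal
      (∀ π : D.MarkovPolicy, RiskMDP.Model.IsArgmin h0 σ T v π →
        RiskMDP.Model.IsOptimal h0 σ g T π.toPolicy) := by
  have hgp : MemLp g p P₀ := by
    obtain ⟨C, hC⟩ := hgw
    refine (hw.memLp.const_mul C).mono hg.aestronglyMeasurable (ae_of_all _ fun x => ?_)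
    rw [Real.norm_eq_abs]
    exact (hC x).trans (le_abs_self _)
  obtain ⟨v₀, π₀, hv₀, hπ₀, hm₀, hp₀⟩ :=
    RiskMDP.Model.exists_solution hp hw hσ h0 h1 h2 h3 h4 hg hgp hJ
  refine ⟨⟨v₀, hv₀, hm₀, hp₀⟩, fun v hv => ?_⟩
  have hvp : ∀ n, 1 ≤ n → n ≤ T → MemLp (v n) p P₀ := fun n hn hnT => by
    rw [hv.eq_of_le hv₀ hnT]
    exact hp₀ n hn hnT
  have hlow : ∀ (π : D.Policy), RiskMDP.Model.WellDefined h0 σ g T π → ∀ x,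
      v 0 x ≤ RiskMDP.Model.J h0 σ g T π x := fun π hπ x =>
    RiskMDP.Model.le_nestedRisk hw hσ h0 h3 hv hvp hπ T 0 (Nat.zero_add T)
      (Fin.elim0, x)
  have heq : ∀ π : D.MarkovPolicy, RiskMDP.Model.IsArgmin h0 σ T v π → ∀ x,
      RiskMDP.Model.J h0 σ g T π.toPolicy x = v 0 x := fun π hπ x => by
    refine RiskMDP.Model.nestedRisk_markov_eq h0 σ π hv.1 (n₀ := 0) (fun n _ hn y => ?_) T 0 le_rfl
      (Nat.zero_add T) _
    rw [RiskMDP.Model.dpValueExt_eq h0 σ _ (π.feasible n y)]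
    refine le_antisymm ((hv.2 n hn y).2 ⟨_, π.feasible n y, rfl⟩) ?_
    obtain ⟨u, hu, h⟩ := (hv.2 n hn y).1
    rw [h]
    exact hπ n hn y u hu
  have hopt : ∀ π : D.MarkovPolicy, RiskMDP.Model.IsArgmin h0 σ T v π →
      RiskMDP.Model.IsOptimal h0 σ g T π.toPolicy := fun π hπ =>
    ⟨hJ π, fun x π' hπ' => (heq π hπ x).trans_le (hlow π' hπ' x)⟩
  have hπv : RiskMDP.Model.IsArgmin h0 σ T v π₀ := fun n hn x u hu => by
    rw [hv.eq_of_le hv₀ hn]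
    exact hπ₀ n hn x u hu
  refine ⟨fun x => ⟨⟨π₀.toPolicy, hJ π₀, (heq π₀ hπv x).symm⟩, ?_⟩, ⟨π₀, hπv, hopt π₀ hπv⟩, hopt⟩
  rintro _ ⟨π, hπ, rfl⟩
  exact hlow π hπ x
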